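/- **Setting.** Let $\mathcal X_i=\bigcup_{l=1}^{k_i}[\underline\kappa_{i,l},\overline\kappa_{i,l}]\subset\mathbb R$ ($i=1,\dots,N$) be finite unions of disjoint compact, possibly singleton, intervals listed in increasing order, $\mu_i$ a Borel probability measure on $\mathcal X_i$, and $\mathcal X=\mathcal X_1\times\dots\times\mathcal X_N$. Let $c_1\in\mathbb R^{K_1}$, let $S_1=\{a\in\mathbb R^{K_1}:L_{in}a\le q_{in},\ L_{eq}a=q_{eq}\}$ be non-empty, let $S_2^*\subset\mathbb R^{K_2^*}$ be a non-empty polytope, let $V,W$ be matrices and $b$ a vector of matching sizes, and $$Q(a,x)=\max_{\lambda\in S_2^*}\langle Va+Wx+b,\lambda\rangle,\quad \phi(a)=\langle c_1,a\rangle+\sup_{\mu\in\Gamma(\mu_1,\dots,\mu_N)}\int Q(a,x)\,\mu(dx),\quad \phi_{DRO}=\inf_{a\in S_1}\phi(a),$$ where $\Gamma(\mu_1,\dots,\mu_N)$ is the set of couplings of $\mu_1,\dots,\mu_N$. For each $i$ let $\kappa_{i,0}<\dots<\kappa_{i,m_i}$ be points of $\mathcal X_i$ (knots) among which are all the end points $\underline\kappa_{i,l},\overline\kappa_{i,l}$.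 Let $g_{i,0}(x)=\frac{(\kappa_{i,1}-x)^+}{\kappa_{i,1}-\kappa_{i,0}}$, $g_{i,j}(x)=\frac{(x-\kappa_{i,j-1})^+}{\kappa_{i,j}-\kappa_{i,j-1}}\wedge\frac{(\kappa_{i,j+1}-x)^+}{\kappa_{i,j+1}-\kappa_{i,j}}$ for $0<j<m_i$, and $g_{i,m_i}(x)=\frac{(x-\kappa_{i,m_i-1})^+}{\kappa_{i,m_i}-\kappa_{i,m_i-1}}$ (with $g_{i,0}=1$ if $m_i=0$). Put $\mathcal G_i=\{g_{i,1},\dots,g_{i,m_i}\}$, $v_{i,j}=\int g_{i,j}\,d\mu_i$, let $[\mu_i]_{\mathcal G_i}$ be the set of probability measures $\nu$ on $\mathcal X_i$ with $\int g\,d\nu=\int g\,d\mu_i$ for all $g\in\mathcal G_i$, and let $\overline W_{1,\mu_i}([\mu_i]_{\mathcal G_i})=\sup_{\nu\in[\mu_i]_{\mathcal G_i}}W_1(\mu_i,\nu)$, with $W_1$ the Wasserstein distance of order 1. Assume: (A1) $\int g_{i,j}\,d\mu_i>0$ for all $i$ and $0\le j\le m_i$; (A2) $c_1$ is an interior point of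 $\mathrm{cone}\{-V^T\lambda:\lambda\in S_2^*\}+\{L_{in}^T\xi:\xi\le0\}+\{L_{eq}^T\xi\}$. **Algorithm 1** (input: $\epsilon>0$ and a finite set $\mathfrak C^{(0)}\subset\mathcal X\times S_2^*$ for which the linear program below with $\mathfrak C=\mathfrak C^{(0)}$ has bounded sublevel sets). Write $u_i(x;y_i)=\sum_{j=1}^{m_i}y_{i,j}g_{i,j}(x)$, $u_i^*(\eta;y_i)=\sup_{x\in\mathcal X_i}\{\eta x-u_i(x;y_i)\}$, $u_i^{**}(x;y_i)=\sup_{\eta\in\mathbb R}\{\eta x-u_i^*(\eta;y_i)\}$. Starting from $\mathfrak C=\mathfrak C^{(0)}$, repeat: (1) compute an optimizer $(\hat a,\hat y_0,\hat y)$ and the optimal value $\underline\varphi$ of the linear program of minimizing $\langle c_1,a\rangle+y_0+\langle v,y\rangle$ subject to $a\in S_1$ and $y_0+\sum_iu_i(x_i;y_i)-\langle V^T\lambda,a\rangle\ge\langle Wx+b,\lambda\rangle$ for all $(x,\lambda)\in\mathfrak C$, and an optimizer $(\hat\xi_{in},\hat\xi_{eq},(\hat\mu_{x,\lambda})_{(x,\lambda)\in\mathfrak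 C})$ of its dual, which maximizes $\langle q_{in},\xi_{in}\rangle+\langle q_{eq},\xi_{eq}\rangle+\sum_{(x,\lambda)\in\mathfrak C}\mu_{x,\lambda}\langle Wx+b,\lambda\rangle$ subject to $L_{in}^T\xi_{in}+L_{eq}^T\xi_{eq}-\sum\mu_{x,\lambda}V^T\lambda=c_1$, $\sum\mu_{x,\lambda}=1$, $\sum\mu_{x,\lambda}g_{i,j}(x_i)=v_{i,j}$ for all $i$ and $1\le j\le m_i$, $\xi_{in}\le0$, $\mu_{x,\lambda}\ge0$; (2) compute a minimizer $\lambda^\star$ and the minimum $s$ of $\hat y_0-\langle V\hat a+b,\lambda\rangle-\sum_iu_i^*([W^T\lambda]_i;\hat y_i)$ over $\lambda\in S_2^*$, and choose a finite set $\mathfrak D^\star\subset S_2^*$ with $\lambda^\star\in\mathfrak D^\star$; (3) choose $\hat y^\diamond\le\hat y$ with $u_i(\cdot\,;\hat y_i^\diamond)=u_i^{**}(\cdot\,;\hat y_i)$ on $\mathcal X_i$ for all $i$, and put $\overline\varphi=\langle c_1,\hat a\rangle+(\hat y_0-s)+\langle v,\hat y^\diamond\rangle$; (4) if $\overline\varphi-\underline\varphi\le\epsilon$,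 stop; otherwise add to $\mathfrak C$, for each $\lambda\in\mathfrak D^\star$, one pair $(x_\lambda,\lambda)$ whose $i$-th coordinate $x_{\lambda,i}$ maximizes $[W^T\lambda]_ix-u_i(x;\hat y_i)$ over the knots $x\in\{\kappa_{i,0},\dots,\kappa_{i,m_i}\}$. **Algorithm 2.** Run Algorithm 1 and use the data of its last pass. List the pairs $(x,\lambda)\in\mathfrak C$ with $\hat\mu_{x,\lambda}>0$ without repetition as $(x_1,\lambda_1),\dots,(x_J,\lambda_J)$, with weights $\alpha_1,\dots,\alpha_J$. For each $i$ let $\sigma_i$ be a permutation of $\{1,\dots,J\}$ ranking $x_{1,i},\dots,x_{J,i}$ in ascending order, and $F_i(l)=\sum_{j:\sigma_i(j)\le l}\alpha_j$. On some probability space take $Z$ with $P[Z=j]=\alpha_j$ and, independent of $Z$, a random vector $(C_1,\dots,C_N)$ with values in $[0,1]^N$ and uniform marginals. Put $\Lambda=\lambda_Z$ and $\tilde X_i=F_{\mu_i}^{-1}\big(C_iF_i(\sigma_i(Z))+(1-C_i)F_i(\sigma_i(Z)-1)\big)$, where $F_{\mu_i}^{-1}(t)=\inf\{x\in\mathcal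 X_i:\mu_i(\mathcal X_i\cap(-\infty,x])\ge t\}$. Return $\hat a$, $\phi^{UB}=\overline\varphi$, $\phi^{LB}=\langle q_{in},\hat\xi_{in}\rangle+\langle q_{eq},\hat\xi_{eq}\rangle+E[\langle W\tilde X+b,\Lambda\rangle]$ and $\hat\epsilon=\phi^{UB}-\phi^{LB}$. **Theorem.** However the choices are made, every step can be carried out, the loop of Algorithm 1 stops after finitely many passes, and Algorithm 2 has an output. Every output $(\phi^{UB},\phi^{LB},\hat\epsilon,\hat a)$ of Algorithm 2 satisfies: (i) $\phi^{LB}\le\phi_{DRO}\le\phi(\hat a)\le\phi^{UB}$; (ii) $\hat a$ is an $\hat\epsilon$-optimal first-stage decision, that is, $\hat a\in S_1$ and $\phi(\hat a)\le\phi_{DRO}+\hat\epsilon$; (iii) $\displaystyle\hat\epsilon\le\epsilon+\Big(\sum_{i=1}^N\overline W_{1,\mu_i}([\mu_i]_{\mathcal G_i})\Big)\sup_{\lambda\in S_2^*}\|W^T\lambda\|_\infty .$ -/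

import Mathlib

open MeasureTheory ProbabilityTheory Matrix
open scoped ENNReal NNReal

universe w

noncomputable section

namespace TwoStageDRO

/-! ### Measures on the real line -/

/-- A polytope in `ℝ^n`: a bounded intersection of finitely many closed half-spaces. -/
def IsPolytope {n : ℕ} (S : Set (Fin n → ℝ)) : Prop :=
  (∃ (r : ℕ) (A : Matrix (Fin r) (Fin n) ℝ) (d : Fin r → ℝ), S = {z | A *ᵥ z ≤ d}) ∧
    Bornology.IsBounded S

/-- Borel probability measures on a closed set `X ⊆ ℝ`, seen as the probability measures on `ℝ`
that are concentrated on `X`. -/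
def IsProbOn (X : Set ℝ) (ν : Measure ℝ) : Prop :=
  IsProbabilityMeasure ν ∧ ν Xᶜ = 0

/-- The Wasserstein distance of order one: the infimum of `∫ |x - y| dγ` over all couplings `γ`. -/
def W1 (μ ν : Measure ℝ) : ℝ≥0∞ :=
  ⨅ γ ∈ {γ : Measure (ℝ × ℝ) | γ.map Prod.fst = μ ∧ γ.map Prod.snd = ν},
    ∫⁻ z, ENNReal.ofReal |z.1 - z.2| ∂γ

/-- The moment set centered at `μ` characterized by the collection `G` of functions on `X`. -/
def momentSet (X : Set ℝ) (G : Set (ℝ → ℝ)) (μ : Measure ℝ) : Set (Measure ℝ) :=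
  {ν | IsProbOn X ν ∧ ∀ g ∈ G, Integrable g ν ∧ ∫ x, g x ∂ν = ∫ x, g x ∂μ}

/-- The supremum `W1`-distance between `μ` and the members of its moment set. -/
def W1bar (X : Set ℝ) (G : Set (ℝ → ℝ)) (μ : Measure ℝ) : ℝ≥0∞ :=
  ⨆ ν ∈ momentSet X G μ, W1 μ ν

/-- The generalized inverse `t ↦ inf {x ∈ X : μ(X ∩ (-∞, x]) ≥ t}` of the distribution function. -/
def quantile (X : Set ℝ) (μ : Measure ℝ) (t : ℝ) : ℝ :=
  sInf {x | x ∈ X ∧ t ≤ μ.real (X ∩ Set.Iic x)}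

/-! ### Continuous piece-wise affine functions -/

/-- The ramp `(x - κ_{j-1})⁺ / (κ_j - κ_{j-1})`, used for `j ≥ 1` only. -/
def rampUp {m : ℕ} (κ : Fin (m + 1) → ℝ) (j : Fin (m + 1)) (x : ℝ) : ℝ :=
  max (x - κ ⟨(j : ℕ) - 1, by omega⟩) 0 / (κ j - κ ⟨(j : ℕ) - 1, by omega⟩)

/-- The ramp `(κ_{j+1} - x)⁺ / (κ_{j+1} - κ_j)`, for `j < m`. -/
def rampDown {m : ℕ} (κ : Fin (m + 1) → ℝ) (j : Fin (m + 1)) (h : (j : ℕ) + 1 < m + 1) (x : ℝ) :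
    ℝ :=
  max (κ ⟨(j : ℕ) + 1, h⟩ - x) 0 / (κ ⟨(j : ℕ) + 1, h⟩ - κ j)

/-- The functions `g_0, …, g_m` associated with knots `κ_0 < ⋯ < κ_m`. In the degenerate case
`m = 0` of a single knot, `g_0` is the constant one (so that `g_0 + ⋯ + g_m = 1` always). -/
def cpwa {m : ℕ} (κ : Fin (m + 1) → ℝ) (j : Fin (m + 1)) (x : ℝ) : ℝ :=
  if (j : ℕ) = 0 then
    if h : (j : ℕ) + 1 < m + 1 then rampDown κ j h x else 1
  else
    if h : (j : ℕ) + 1 < m + 1 then min (rampUp κ j x) (rampDown κ j h x) else rampUp κ j x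

/-- The collection `{g_1, …, g_m}` (empty if `m = 0`). -/
def cpwaSet {m : ℕ} (κ : Fin (m + 1) → ℝ) : Set (ℝ → ℝ) :=
  Set.range fun j : Fin m => cpwa κ j.succ

/-! ### The two-stage problem -/

/-- The data of the two-stage problem together with the knots of the moment sets. The space of the
`i`-th uncertain quantity is `⋃ l, [lo i l, hi i l]`; `knot i` lists the knots of all these
intervals in increasing order, relabelled as `κ_{i,0} < ⋯ < κ_{i,m i}`. -/
structure Data (N K₁ nin neq K₂ : ℕ) where
  numInt : Fin N → ℕ
  lo : (i : Fin N) → Fin (numInt i) → ℝ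
  hi : (i : Fin N) → Fin (numInt i) → ℝ
  μ : Fin N → Measure ℝ
  c₁ : Fin K₁ → ℝ
  Lin : Matrix (Fin nin) (Fin K₁) ℝ
  qin : Fin nin → ℝ
  Leq : Matrix (Fin neq) (Fin K₁) ℝ
  qeq : Fin neq → ℝ
  V : Matrix (Fin K₂) (Fin K₁) ℝ
  W : Matrix (Fin K₂) (Fin N) ℝ
  b : Fin K₂ → ℝ
  S₂ : Set (Fin K₂ → ℝ)
  m : Fin N → ℕ
  knot : (i : Fin N) → Fin (m i + 1) → ℝ

namespace Data

variable {N K₁ nin neq K₂ : ℕ} (D : Data N K₁ nin neq K₂)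

/-- The space of the `i`-th uncertain quantity. -/
def X (i : Fin N) : Set ℝ := ⋃ l, Set.Icc (D.lo i l) (D.hi i l)

/-- The product of the spaces of the uncertain quantities. -/
def XX : Set (Fin N → ℝ) := {x | ∀ i, x i ∈ D.X i}

/-- The first-stage feasible set. -/
def S₁ : Set (Fin K₁ → ℝ) := {a | D.Lin *ᵥ a ≤ D.qin ∧ D.Leq *ᵥ a = D.qeq}

/-- The standing assumptions on the problem and on the knots. The last two fields say that the
knots in each interval `[lo i l, hi i l]` form a finite subset of it containing both end points
(a single knot if the interval is a singleton). -/
structure Assumptions : Prop where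
  lo_le_hi : ∀ i l, D.lo i l ≤ D.hi i l
  hi_lt_lo : ∀ i l l', l < l' → D.hi i l < D.lo i l'
  prob : ∀ i, IsProbOn (D.X i) (D.μ i)
  S₁_nonempty : D.S₁.Nonempty
  S₂_nonempty : D.S₂.Nonempty
  S₂_polytope : IsPolytope D.S₂
  knot_strictMono : ∀ i, StrictMono (D.knot i)
  knot_mem : ∀ i j, D.knot i j ∈ D.X i
  endpoint_mem : ∀ i l, D.lo i l ∈ Set.range (D.knot i) ∧ D.hi i l ∈ Set.range (D.knot i)

/-- The second-stage cost `Q(a, x) = max_{λ ∈ S₂} ⟨V a + W x + b, λ⟩`. -/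
def Q (a : Fin K₁ → ℝ) (x : Fin N → ℝ) : ℝ :=
  sSup ((fun lam => (D.V *ᵥ a + D.W *ᵥ x + D.b) ⬝ᵥ lam) '' D.S₂)

/-- The couplings of `μ_1, …, μ_N` (they are automatically concentrated on the product space). -/
def couplings : Set (Measure (Fin N → ℝ)) :=
  {π | IsProbabilityMeasure π ∧ ∀ i, π.map (fun x => x i) = D.μ i}

/-- The worst-case expected cost of the first-stage decision `a`. -/
def φ (a : Fin K₁ → ℝ) : EReal :=
  ((D.c₁ ⬝ᵥ a : ℝ) : EReal) + ⨆ π ∈ D.couplings, ((∫ x, D.Q a x ∂π : ℝ) : EReal)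

/-- The optimal value of the two-stage problem. -/
def φDRO : EReal := ⨅ a ∈ D.S₁, D.φ a

/-- `a` is an `e`-optimal first-stage decision. -/
def IsOptimalUpTo (e : ℝ) (a : Fin K₁ → ℝ) : Prop :=
  a ∈ D.S₁ ∧ D.φ a ≤ D.φDRO + (e : EReal)

/-- The functions `g_{i,0}, …, g_{i,m i}`. -/
def g₀ (i : Fin N) (j : Fin (D.m i + 1)) (x : ℝ) : ℝ := cpwa (D.knot i) j x

/-- The functions `g_{i,1}, …, g_{i,m i}` that characterize the moment sets (re-indexed from 0). -/
def g (i : Fin N) (j : Fin (D.m i)) (x : ℝ) : ℝ := D.g₀ i j.succ x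

/-- The moments `v_{i,j} = ∫ g_{i,j} dμ_i`. -/
def v (i : Fin N) (j : Fin (D.m i)) : ℝ := ∫ x, D.g i j x ∂(D.μ i)

/-- Condition (A1). -/
def CondA1 : Prop := ∀ (i : Fin N) (j : Fin (D.m i + 1)), 0 < ∫ x, D.g₀ i j x ∂(D.μ i)

/-- The convex cone in condition (A2); `Submodule.span ℝ≥0` is the conic hull. -/
def dualCone : Set (Fin K₁ → ℝ) :=
  {c | ∃ u ∈ Submodule.span ℝ≥0 ((fun lam => -(D.Vᵀ *ᵥ lam)) '' D.S₂),
    ∃ ξin : Fin nin → ℝ, ξin ≤ 0 ∧ ∃ ξeq : Fin neq → ℝ,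
      c = u + D.Linᵀ *ᵥ ξin + D.Leqᵀ *ᵥ ξeq}

/-- Condition (A2). -/
def CondA2 : Prop := D.c₁ ∈ interior D.dualCone

/-! ### The linear programming relaxations -/

/-- The pairs `(x, λ)`. -/
abbrev Point (_D : Data N K₁ nin neq K₂) : Type := (Fin N → ℝ) × (Fin K₂ → ℝ)

/-- The coefficient vectors `y = (y_{i,j})`. -/
abbrev Coef (D : Data N K₁ nin neq K₂) : Type := (i : Fin N) → Fin (D.m i) → ℝ

/-- `u_i(x; y_i) = ∑_j y_{i,j} g_{i,j}(x)`. -/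
def u (i : Fin N) (y : Fin (D.m i) → ℝ) (x : ℝ) : ℝ := ∑ j, y j * D.g i j x

/-- The feasible set of the relaxation with feasibility cuts `cuts`; a variable is a triple
`(a, y₀, y)`. -/
def relaxFeasible (cuts : Set D.Point) : Set ((Fin K₁ → ℝ) × ℝ × D.Coef) :=
  {w | (∀ z ∈ cuts, (D.W *ᵥ z.1 + D.b) ⬝ᵥ z.2 ≤
        w.2.1 + (∑ i, D.u i (w.2.2 i) (z.1 i)) - (D.Vᵀ *ᵥ z.2) ⬝ᵥ w.1) ∧
      D.Lin *ᵥ w.1 ≤ D.qin ∧ D.Leq *ᵥ w.1 = D.qeq}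

/-- The objective `⟨c₁, a⟩ + y₀ + ⟨v, y⟩`. -/
def relaxObj (w : (Fin K₁ → ℝ) × ℝ × D.Coef) : ℝ :=
  D.c₁ ⬝ᵥ w.1 + w.2.1 + ∑ i, ∑ j, D.v i j * w.2.2 i j

/-- The relaxation has bounded sublevel sets. -/
def BoundedSublevel (cuts : Set D.Point) : Prop :=
  ∀ t : ℝ, Bornology.IsBounded {w | w ∈ D.relaxFeasible cuts ∧ D.relaxObj w ≤ t}

/-- `w` is an optimizer of the relaxation. -/
def IsRelaxOptimizer (cuts : Finset D.Point) (w : (Fin K₁ → ℝ) × ℝ × D.Coef) : Prop :=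
  w ∈ D.relaxFeasible (cuts : Set D.Point) ∧
    ∀ w' ∈ D.relaxFeasible (cuts : Set D.Point), D.relaxObj w ≤ D.relaxObj w'

/-- Feasibility for the dual of the relaxation. Only the values of the weights `p` on `cuts`
matter. -/
def DualFeasible (cuts : Finset D.Point) (ξin : Fin nin → ℝ) (ξeq : Fin neq → ℝ)
    (p : D.Point → ℝ) : Prop :=
  D.Linᵀ *ᵥ ξin + D.Leqᵀ *ᵥ ξeq - ∑ z ∈ cuts, p z • (D.Vᵀ *ᵥ z.2) = D.c₁ ∧
    ∑ z ∈ cuts, p z = 1 ∧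
    (∀ i j, ∑ z ∈ cuts, p z * D.g i j (z.1 i) = D.v i j) ∧
    ξin ≤ 0 ∧ ∀ z ∈ cuts, 0 ≤ p z

/-- The objective of the dual of the relaxation. -/
def dualObj (cuts : Finset D.Point) (ξin : Fin nin → ℝ) (ξeq : Fin neq → ℝ)
    (p : D.Point → ℝ) : ℝ :=
  D.qin ⬝ᵥ ξin + D.qeq ⬝ᵥ ξeq + ∑ z ∈ cuts, p z * ((D.W *ᵥ z.1 + D.b) ⬝ᵥ z.2)

/-- `(ξin, ξeq, p)` is an optimizer of the dual of the relaxation. -/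
def IsDualOptimizer (cuts : Finset D.Point) (ξin : Fin nin → ℝ) (ξeq : Fin neq → ℝ)
    (p : D.Point → ℝ) : Prop :=
  D.DualFeasible cuts ξin ξeq p ∧
    ∀ ξin' ξeq' p', D.DualFeasible cuts ξin' ξeq' p' →
      D.dualObj cuts ξin' ξeq' p' ≤ D.dualObj cuts ξin ξeq p

/-! ### The global optimization problem -/

/-- The convex conjugate of `u_i(· ; y_i)` on `X_i`. -/
def conj (i : Fin N) (y : Fin (D.m i) → ℝ) (η : ℝ) : ℝ :=
  sSup ((fun x => η * x - D.u i y x) '' D.X i)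

/-- The convex bi-conjugate of `u_i(· ; y_i)`. -/
def biconj (i : Fin N) (y : Fin (D.m i) → ℝ) (x : ℝ) : ℝ :=
  ⨆ η : ℝ, η * x - D.conj i y η

/-- The objective `y₀ - ⟨V a + b, λ⟩ - u^*(Wᵀ λ; y)` of the global optimization problem. -/
def globalObj (a : Fin K₁ → ℝ) (y₀ : ℝ) (y : D.Coef) (lam : Fin K₂ → ℝ) : ℝ :=
  y₀ - (D.V *ᵥ a + D.b) ⬝ᵥ lam - ∑ i, D.conj i (y i) ((D.Wᵀ *ᵥ lam) i)

/-! ### The cutting-plane algorithm -/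

/-- Everything that is computed in one pass of the loop, up to the termination test. -/
structure Iterate (D : Data N K₁ nin neq K₂) where
  a : Fin K₁ → ℝ
  y₀ : ℝ
  y : D.Coef
  ξin : Fin nin → ℝ
  ξeq : Fin neq → ℝ
  p : D.Point → ℝ
  lamStar : Fin K₂ → ℝ
  dirs : Finset (Fin K₂ → ℝ)
  yDiam : D.Coef

namespace Iterate

variable {D} (I : Iterate D)

/-- The optimal value of the relaxation, i.e. the lower bound. -/
def lower : ℝ := D.relaxObj (I.a, I.y₀, I.y)

/-- The optimal value of the global optimization problem. -/
def s : ℝ := D.globalObj I.a I.y₀ I.y I.lamStar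

/-- The corrected intercept. -/
def y₀Diam : ℝ := I.y₀ - I.s

/-- The upper bound. -/
def upper : ℝ := D.relaxObj (I.a, I.y₀Diam, I.yDiam)

/-- `I` is an admissible result of one pass of the loop with the current set `cuts`: optimizers of
the relaxation and of its dual, an optimizer `lamStar` of the global problem, a finite set `dirs`
of directions containing it, and coefficients `yDiam ≤ y` representing the bi-conjugates. -/
structure IsValid (cuts : Finset D.Point) : Prop where
  primal : D.IsRelaxOptimizer cuts (I.a, I.y₀, I.y)
  dual : D.IsDualOptimizer cuts I.ξin I.ξeq I.p
  lamStar_mem : I.lamStar ∈ D.S₂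
  lamStar_opt : ∀ lam ∈ D.S₂, I.s ≤ D.globalObj I.a I.y₀ I.y lam
  dirs_subset : (I.dirs : Set (Fin K₂ → ℝ)) ⊆ D.S₂
  lamStar_mem_dirs : I.lamStar ∈ I.dirs
  yDiam_le : ∀ i, I.yDiam i ≤ I.y i
  yDiam_eq : ∀ i, ∀ x ∈ D.X i, D.u i (I.yDiam i) x = D.biconj i (I.y i) x

open Classical in
/-- `cuts'` arises from `cuts` by adding, for each direction `λ` in `dirs`, a cut `(x_λ, λ)` whose
`i`-th coordinate maximizes `[Wᵀ λ]_i x - u_i(x; y_i)` over the knots. -/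
def IsUpdate (cuts cuts' : Finset D.Point) : Prop :=
  ∃ x : (Fin K₂ → ℝ) → (Fin N → ℝ),
    (∀ lam ∈ I.dirs, ∀ i, x lam i ∈ Set.range (D.knot i) ∧
      ∀ x' ∈ Set.range (D.knot i),
        (D.Wᵀ *ᵥ lam) i * x' - D.u i (I.y i) x' ≤
          (D.Wᵀ *ᵥ lam) i * x lam i - D.u i (I.y i) (x lam i)) ∧
    cuts' = cuts ∪ I.dirs.image (fun lam => (x lam, lam))

end Iterate

/-- One full pass of the loop, computing `I` and replacing `cuts` by `cuts'`, in which the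
termination test fails. -/
def IsStep (ε : ℝ) (cuts : Finset D.Point) (I : Iterate D) (cuts' : Finset D.Point) : Prop :=
  I.IsValid cuts ∧ ε < I.upper - I.lower ∧ I.IsUpdate cuts cuts'

/-- The sets of cuts that some execution started at `cuts₀` can reach. -/
inductive Reachable (ε : ℝ) (cuts₀ : Finset D.Point) : Finset D.Point → Prop
  | start : Reachable ε cuts₀ cuts₀
  | step {cuts cuts' : Finset D.Point} {I : Iterate D} :
      Reachable ε cuts₀ cuts → D.IsStep ε cuts I cuts' → Reachable ε cuts₀ cuts'

/-- The cutting-plane algorithm, however its choices are made, can carry out each of its steps and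
stops after finitely many passes of the loop. -/
def AlwaysTerminates (ε : ℝ) (cuts₀ : Finset D.Point) : Prop :=
  (∀ cuts, D.Reachable ε cuts₀ cuts →
    (∃ I : Iterate D, I.IsValid cuts) ∧
      ∀ I : Iterate D, I.IsValid cuts → ∃ cuts', I.IsUpdate cuts cuts') ∧
  ¬ ∃ (cuts : ℕ → Finset D.Point) (I : ℕ → Iterate D),
      cuts 0 = cuts₀ ∧ ∀ r, D.IsStep ε (cuts r) (I r) (cuts (r + 1))

/-- Some execution of the cutting-plane algorithm stops with the set `cuts` of cuts and the data
`I` computed in the last pass. -/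
def StopsWith (ε : ℝ) (cuts₀ cuts : Finset D.Point) (I : Iterate D) : Prop :=
  D.Reachable ε cuts₀ cuts ∧ I.IsValid cuts ∧ I.upper - I.lower ≤ ε

/-! ### The partial reassembly and the overall procedure -/

/-- `F(l)`: the total weight of the atoms whose order (counted from 1) is at most `l`, where `σ j`
is the order of the `j`-th atom (counted from 0). -/
def cumWeight {J : ℕ} (α : Fin J → ℝ) (σ : Equiv.Perm (Fin J)) (l : ℕ) : ℝ :=
  ∑ j, if (σ j : ℕ) + 1 ≤ l then α j else 0

/-- The random vector `(Xt, Lam)` on the probability space `(Ω, P)` is constructed from the discrete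
measure `∑_{z ∈ cuts} p z δ_z`: its atoms of positive weight are listed without repetition as
`pts 0, …, pts (J - 1)`; `σ i` sorts the `i`-th coordinates of the atoms in ascending order; `Z` is
categorical with the weights of the atoms; `C` is independent of `Z` and has uniform marginals. -/
def IsReassembly {Ω : Type*} [MeasurableSpace Ω] (P : Measure Ω) (cuts : Finset D.Point)
    (p : D.Point → ℝ) (Xt : Ω → Fin N → ℝ) (Lam : Ω → Fin K₂ → ℝ) : Prop :=
  IsProbabilityMeasure P ∧
  ∃ (J : ℕ) (pts : Fin J → D.Point) (σ : Fin N → Equiv.Perm (Fin J))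
    (Z : Ω → Fin J) (C : Ω → Fin N → ℝ),
    Function.Injective pts ∧
    (∀ z, z ∈ Set.range pts ↔ z ∈ cuts ∧ 0 < p z) ∧
    (∀ i, Monotone fun l => (pts ((σ i).symm l)).1 i) ∧
    Measurable Z ∧ (∀ j, P.real {ω | Z ω = j} = p (pts j)) ∧
    Measurable C ∧ (∀ ω i, C ω i ∈ Set.Icc (0 : ℝ) 1) ∧
    (∀ i, P.map (fun ω => C ω i) = volume.restrict (Set.Icc (0 : ℝ) 1)) ∧
    IndepFun C Z P ∧
    (∀ ω, Lam ω = (pts (Z ω)).2) ∧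
    ∀ ω i, Xt ω i = quantile (D.X i) (D.μ i)
      (C ω i * cumWeight (fun j => p (pts j)) (σ i) ((σ i (Z ω) : ℕ) + 1) +
        (1 - C ω i) * cumWeight (fun j => p (pts j)) (σ i) (σ i (Z ω) : ℕ))

/-- `(UB, LB, εhat, ahat)` is an output of the overall procedure: run the cutting-plane algorithm,
construct a partial reassembly of the resulting discrete measure, and compute the two bounds and
their difference. -/
def IsOutput (ε : ℝ) (cuts₀ : Finset D.Point) (UB LB εhat : ℝ) (ahat : Fin K₁ → ℝ) : Prop :=
  ∃ (cuts : Finset D.Point) (I : Iterate D), D.StopsWith ε cuts₀ cuts I ∧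
    ∃ (Ω : Type w) (_ : MeasurableSpace Ω) (P : Measure Ω)
      (Xt : Ω → Fin N → ℝ) (Lam : Ω → Fin K₂ → ℝ),
      D.IsReassembly P cuts I.p Xt Lam ∧
      UB = I.upper ∧
      LB = D.qin ⬝ᵥ I.ξin + D.qeq ⬝ᵥ I.ξeq + ∫ ω, (D.W *ᵥ Xt ω + D.b) ⬝ᵥ Lam ω ∂P ∧
      εhat = UB - LB ∧
      ahat = I.a

end Data

end TwoStageDRO

end

namespace TwoStageDRO

/-! ### The interpolation basis -/

section Cpwa

variable {m : ℕ} {κ : Fin (m + 1) → ℝ}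

/-! Upper bound. If a triple `(a, y₀, y)` satisfies the cuts for all pairs in `XX × S₂`, then `Q a`
is majorised on `XX` by a constant plus functions of single coordinates, and the integral of such a
sum is the same for every coupling. The current optimizer becomes such a triple once `y₀` is
corrected by the global minimum `s` and each `u i` is replaced by its biconjugate. The biconjugate
is again piecewise affine with the same knots and the value 0 at the first one, so it has
coefficients `yDiam` (`biconjOn_eq_interp`, `biconjOn_knot_zero`, `Q_le`, `φ_le_upper`).

Lower bound. A dual optimizer is a finitely supported law of pairs `(x, λ)`. Reassembly moves the
coordinates of `x` onto the marginals `μ i` and leaves `λ` alone. This gives a genuine coupling,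
while the terms in `Vᵀ λ` keep their expectation, so the dual equation still cancels the dependence
on `a` (`lower_le_φDRO`).

Gap. At termination the upper bound exceeds the relaxation value by at most `ε`, and strong duality
(`exists_lp_multipliers`) identifies that value with the dual one. The remaining loss is the cost of
the reassembly. Each coordinate is moved comonotonically, hence at cost `W1` between `μ i` and the
discrete marginal (`lintegral_abs_sub_le_W1`); the dual constraints place that marginal in the
moment set (`dualObj_sub_le`).

Termination. The gap is at most `-s`, and the cut added at `lamStar` has slack exactly `s` at the
current optimizer, because conjugates are attained at knots. A pass that does not stop thus adds a
cut violated by more than `ε`, which all later optimizers satisfy. Cuts and optimizers range over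
compact sets, so an infinite run is contradictory in the limit (`not_exists_infinite_run`). -/

lemma rampUp_nonneg (hκ : StrictMono κ) (k : Fin (m + 1)) (x : ℝ) : 0 ≤ rampUp κ k x := by
  refine div_nonneg (le_max_right _ _) (sub_nonneg.2 (hκ.monotone ?_))
  simp [Fin.le_def]

lemma rampDown_nonneg (hκ : StrictMono κ) (k : Fin (m + 1)) (h : (k : ℕ) + 1 < m + 1) (x : ℝ) :
    0 ≤ rampDown κ k h x := by
  refine div_nonneg (le_max_right _ _) (sub_nonneg.2 (hκ.monotone ?_))
  simp [Fin.le_def]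

lemma rampUp_eq_zero {k : Fin (m + 1)} {x : ℝ} (hx : x ≤ κ ⟨(k : ℕ) - 1, by omega⟩) :
    rampUp κ k x = 0 := by
  rw [rampUp, max_eq_right (by linarith), zero_div]

lemma rampDown_eq_zero {k : Fin (m + 1)} {h : (k : ℕ) + 1 < m + 1} {x : ℝ}
    (hx : κ ⟨(k : ℕ) + 1, h⟩ ≤ x) : rampDown κ k h x = 0 := by
  rw [rampDown, max_eq_right (by linarith), zero_div]

lemma one_le_rampUp (hκ : StrictMono κ) {k : Fin (m + 1)} (hk : (k : ℕ) ≠ 0) {x : ℝ}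
    (hx : κ k ≤ x) : 1 ≤ rampUp κ k x := by
  have h : κ ⟨(k : ℕ) - 1, by omega⟩ < κ k := hκ (Fin.mk_lt_mk.2 (by omega))
  rw [rampUp, one_le_div (by linarith)]
  exact le_max_of_le_left (by linarith)

lemma one_le_rampDown (hκ : StrictMono κ) {k : Fin (m + 1)} {h : (k : ℕ) + 1 < m + 1} {x : ℝ}
    (hx : x ≤ κ k) : 1 ≤ rampDown κ k h x := by
  have h' : κ k < κ ⟨(k : ℕ) + 1, h⟩ := hκ (Fin.mk_lt_mk.2 (Nat.lt_succ_self _))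
  rw [rampDown, one_le_div (by linarith)]
  exact le_max_of_le_left (by linarith)

lemma cpwa_nonneg (hκ : StrictMono κ) (k : Fin (m + 1)) (x : ℝ) : 0 ≤ cpwa κ k x := by
  unfold cpwa
  split_ifs
  · exact rampDown_nonneg hκ _ _ _
  · exact zero_le_one
  · exact le_min (rampUp_nonneg hκ _ _) (rampDown_nonneg hκ _ _ _)
  · exact rampUp_nonneg hκ _ _

lemma continuous_cpwa (k : Fin (m + 1)) : Continuous (cpwa κ k) := by
  unfold cpwa rampUp rampDown
  split_ifs <;> fun_prop

/-- Away from the two adjacent knots one of the ramps vanishes. At an adjacent knot the ramp that is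
not active is at least 1 while the active one is at most 1, so the minimum is affine on the segment.
-/
lemma cpwa_of_mem_segment (hκ : StrictMono κ) (j : Fin m) {x : ℝ} (hx₁ : κ j.castSucc ≤ x)
    (hx₂ : x ≤ κ j.succ) (k : Fin (m + 1)) :
    cpwa κ k x = if k = j.castSucc then (κ j.succ - x) / (κ j.succ - κ j.castSucc)
      else if k = j.succ then (x - κ j.castSucc) / (κ j.succ - κ j.castSucc) else 0 := by
  have hab : κ j.castSucc < κ j.succ := hκ Fin.castSucc_lt_succ
  obtain hk | hk | hk | hk : (k : ℕ) < j ∨ (k : ℕ) = j ∨ (k : ℕ) = j + 1 ∨ (j : ℕ) + 1 < k := by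
    omega
  · have h : (k : ℕ) + 1 < m + 1 := by omega
    have hd : rampDown κ k h x = 0 := rampDown_eq_zero
      ((hκ.monotone (by simp [Fin.le_def]; omega)).trans hx₁)
    rw [if_neg (by simp [Fin.ext_iff]; omega), if_neg (by simp [Fin.ext_iff]; omega), cpwa,
      dif_pos h, dif_pos h, hd, min_eq_right (rampUp_nonneg hκ _ _), ite_self]
  · obtain rfl : k = j.castSucc := Fin.ext hk
    have h : ((j.castSucc : Fin (m + 1)) : ℕ) + 1 < m + 1 := by simp
    have hd : rampDown κ j.castSucc h x = (κ j.succ - x) / (κ j.succ - κ j.castSucc) := by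
      have : (⟨(j.castSucc : ℕ) + 1, h⟩ : Fin (m + 1)) = j.succ := Fin.ext (by simp)
      rw [rampDown, this, max_eq_left (by linarith)]
    rw [if_pos rfl, cpwa, dif_pos h, dif_pos h, hd]
    split_ifs with h0
    · rfl
    · refine min_eq_right (le_trans ?_ (one_le_rampUp hκ h0 hx₁))
      rw [div_le_one (by linarith)]
      linarith
  · obtain rfl : k = j.succ := Fin.ext (by simpa using hk)
    have hu : rampUp κ j.succ x = (x - κ j.castSucc) / (κ j.succ - κ j.castSucc) := by
      have : (⟨(j.succ : ℕ) - 1, by omega⟩ : Fin (m + 1)) = j.castSucc := Fin.ext (by simp)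
      rw [rampUp, this, max_eq_left (by linarith)]
    rw [if_neg (by simp [Fin.ext_iff]), if_pos rfl, cpwa, if_neg (by simp), hu]
    split_ifs with h
    · refine min_eq_left (le_trans ?_ (one_le_rampDown hκ hx₂))
      rw [div_le_one (by linarith)]
      linarith
    · rfl
  · have hu : rampUp κ k x = 0 := rampUp_eq_zero
      (hx₂.trans (hκ.monotone (by simp [Fin.le_def]; omega)))
    rw [if_neg (by simp [Fin.ext_iff]; omega), if_neg (by simp [Fin.ext_iff]; omega), cpwa,
      if_neg (by omega), hu]
    split_ifs with h
    · exact min_eq_left (rampDown_nonneg hκ _ _ _)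
    · rfl

lemma cpwa_knot (hκ : StrictMono κ) (k l : Fin (m + 1)) :
    cpwa κ k (κ l) = if k = l then 1 else 0 := by
  rcases Nat.eq_zero_or_pos m with rfl | hm
  · obtain rfl : k = l := Subsingleton.elim (α := Fin 1) _ _
    simp [cpwa]
  · by_cases hl : (l : ℕ) < m
    · obtain ⟨j, rfl⟩ : ∃ j : Fin m, l = j.castSucc := ⟨⟨l, hl⟩, rfl⟩
      have hab : κ j.castSucc < κ j.succ := hκ Fin.castSucc_lt_succ
      rw [cpwa_of_mem_segment hκ j le_rfl hab.le, div_self (by linarith), sub_self, zero_div,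
        ite_self]
    · obtain ⟨j, rfl⟩ : ∃ j : Fin m, l = j.succ :=
        ⟨⟨m - 1, by omega⟩, Fin.ext (by simp; omega)⟩
      have hab : κ j.castSucc < κ j.succ := hκ Fin.castSucc_lt_succ
      rw [cpwa_of_mem_segment hκ j hab.le le_rfl, div_self (by linarith), sub_self, zero_div]
      split_ifs with h1 h2 h2
      · exact absurd (h1.symm.trans h2) Fin.castSucc_lt_succ.ne
      all_goals rfl

/-- Without a segment around `x`, induction along the knots puts all of them below `x`, so `x` is
the last one. The first alternative is indispensable only for a single knot. -/
lemma exists_segment {x : ℝ} (h0 : κ 0 ≤ x) (hm : x ≤ κ (Fin.last m)) :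
    (∃ k, κ k = x) ∨ ∃ j : Fin m, κ j.castSucc ≤ x ∧ x ≤ κ j.succ := by
  by_contra! h
  have : ∀ k, κ k ≤ x := fun k =>
    Fin.induction h0 (fun j hj => (h.2 j hj).le) k
  exact h.1 _ (le_antisymm (this _) hm)

/-- The piecewise affine function with the values `Y` at the knots. -/
noncomputable def interp (κ : Fin (m + 1) → ℝ) (Y : Fin (m + 1) → ℝ) (x : ℝ) : ℝ := ∑ k, Y k * cpwa κ k x

lemma interp_knot (hκ : StrictMono κ) (Y : Fin (m + 1) → ℝ) (k : Fin (m + 1)) :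
    interp κ Y (κ k) = Y k := by
  simp [interp, cpwa_knot hκ]

lemma interp_of_mem_segment (hκ : StrictMono κ) (Y : Fin (m + 1) → ℝ) (j : Fin m) {x : ℝ}
    (hx₁ : κ j.castSucc ≤ x) (hx₂ : x ≤ κ j.succ) :
    interp κ Y x = Y j.castSucc * ((κ j.succ - x) / (κ j.succ - κ j.castSucc)) +
      Y j.succ * ((x - κ j.castSucc) / (κ j.succ - κ j.castSucc)) := by
  have hne : j.castSucc ≠ j.succ := Fin.castSucc_lt_succ.ne
  rw [interp, ← Finset.add_sum_erase _ _ (Finset.mem_univ j.castSucc),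
    ← Finset.add_sum_erase _ _ (Finset.mem_erase.2 ⟨hne.symm, Finset.mem_univ j.succ⟩),
    Finset.sum_eq_zero, add_zero, cpwa_of_mem_segment hκ j hx₁ hx₂,
    cpwa_of_mem_segment hκ j hx₁ hx₂, if_pos rfl, if_neg hne.symm, if_pos rfl]
  intro k hk
  rw [Finset.mem_erase, Finset.mem_erase] at hk
  rw [cpwa_of_mem_segment hκ j hx₁ hx₂, if_neg hk.2.1, if_neg hk.1, mul_zero]

/-- The weights do not depend on `Y`. The segment may span a gap of `X`; its end points are knots,
which is all that the convexity arguments below require to lie in `X`. -/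
lemma exists_segment_weights (hκ : StrictMono κ) {x : ℝ} (h0 : κ 0 ≤ x)
    (hm : x ≤ κ (Fin.last m)) :
    (∃ k, κ k = x) ∨ ∃ j : Fin m, ∃ s t : ℝ, 0 ≤ s ∧ 0 ≤ t ∧ s + t = 1 ∧
      x = s * κ j.castSucc + t * κ j.succ ∧
      ∀ Y, interp κ Y x = s * Y j.castSucc + t * Y j.succ := by
  refine (exists_segment h0 hm).imp_right ?_
  rintro ⟨j, h1, h2⟩
  have hab : 0 < κ j.succ - κ j.castSucc := sub_pos.2 (hκ Fin.castSucc_lt_succ)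
  refine ⟨j, (κ j.succ - x) / (κ j.succ - κ j.castSucc),
    (x - κ j.castSucc) / (κ j.succ - κ j.castSucc), div_nonneg (by linarith) hab.le,
    div_nonneg (by linarith) hab.le, ?_, ?_, fun Y => ?_⟩
  · field_simp
    ring
  · field_simp
    ring
  · rw [interp_of_mem_segment hκ Y j h1 h2]
    ring

lemma exists_knot_affine_sub_interp_le (hκ : StrictMono κ) (Y : Fin (m + 1) → ℝ) (η : ℝ) {x : ℝ}
    (h0 : κ 0 ≤ x) (hm : x ≤ κ (Fin.last m)) :
    ∃ k, η * x - interp κ Y x ≤ η * κ k - Y k := by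
  rcases exists_segment_weights hκ h0 hm with ⟨k, rfl⟩ | ⟨j, s, t, hs, ht, hst, rfl, hY⟩
  · exact ⟨k, by rw [interp_knot hκ]⟩
  · rw [hY]
    rcases le_total (η * κ j.castSucc - Y j.castSucc) (η * κ j.succ - Y j.succ) with h | h
    · refine ⟨j.succ, ?_⟩
      have := mul_le_mul_of_nonneg_left h hs
      obtain rfl : t = 1 - s := by linarith
      nlinarith
    · refine ⟨j.castSucc, ?_⟩
      have := mul_le_mul_of_nonneg_left h ht
      obtain rfl : s = 1 - t := by linarith
      nlinarith

end Cpwa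

/-! ### Conjugates of piecewise affine functions -/

section Conj

variable {m : ℕ} {κ : Fin (m + 1) → ℝ} {X : Set ℝ}

/-- The convex conjugate of the function `f` on `X`. -/
noncomputable def conjOn (X : Set ℝ) (f : ℝ → ℝ) (η : ℝ) : ℝ := sSup ((fun x => η * x - f x) '' X)

/-- The convex biconjugate of the function `f` on `X`. -/
noncomputable def biconjOn (X : Set ℝ) (f : ℝ → ℝ) (x : ℝ) : ℝ := ⨆ η : ℝ, η * x - conjOn X f η

/-- An affine function minus the interpolant is affine on each segment, hence largest at a knot, and
knots lie in `X`. The conjugate is therefore a maximum over finitely many knots. -/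
lemma exists_conjOn_interp_eq (hκ : StrictMono κ) (hk : ∀ k, κ k ∈ X)
    (hX : X ⊆ Set.Icc (κ 0) (κ (Fin.last m))) (Y : Fin (m + 1) → ℝ) (η : ℝ) :
    ∃ k, conjOn X (interp κ Y) η = η * κ k - Y k ∧ ∀ l, η * κ l - Y l ≤ η * κ k - Y k := by
  obtain ⟨k, hmax⟩ := Finite.exists_max fun k => η * κ k - Y k
  refine ⟨k, IsGreatest.csSup_eq ⟨⟨κ k, hk k, by simp only [interp_knot hκ]⟩, ?_⟩, hmax⟩
  rintro _ ⟨x, hx, rfl⟩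
  obtain ⟨l, hl⟩ := exists_knot_affine_sub_interp_le hκ Y η (hX hx).1 (hX hx).2
  exact hl.trans (hmax l)

lemma affine_sub_le_conjOn (hκ : StrictMono κ) (hX : X ⊆ Set.Icc (κ 0) (κ (Fin.last m)))
    (Y : Fin (m + 1) → ℝ) (η : ℝ) {x : ℝ} (hx : x ∈ X) :
    η * x - interp κ Y x ≤ conjOn X (interp κ Y) η := by
  refine le_csSup ?_ ⟨x, hx, rfl⟩
  obtain ⟨k, hmax⟩ := Finite.exists_max fun k => η * κ k - Y k
  refine ⟨η * κ k - Y k, ?_⟩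
  rintro _ ⟨x, hx, rfl⟩
  obtain ⟨l, hl⟩ := exists_knot_affine_sub_interp_le hκ Y η (hX hx).1 (hX hx).2
  exact hl.trans (hmax l)

lemma affine_sub_conjOn_le_interp (hκ : StrictMono κ) (hX : X ⊆ Set.Icc (κ 0) (κ (Fin.last m)))
    (Y : Fin (m + 1) → ℝ) (η : ℝ) {x : ℝ} (hx : x ∈ X) :
    η * x - conjOn X (interp κ Y) η ≤ interp κ Y x := by
  linarith [affine_sub_le_conjOn hκ hX Y η hx]

lemma affine_sub_conjOn_le_biconjOn (hκ : StrictMono κ)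
    (hX : X ⊆ Set.Icc (κ 0) (κ (Fin.last m))) (Y : Fin (m + 1) → ℝ) (η : ℝ) {x : ℝ}
    (hx : x ∈ X) :
    η * x - conjOn X (interp κ Y) η ≤ biconjOn X (interp κ Y) x :=
  le_ciSup (f := fun η : ℝ => η * x - conjOn X (interp κ Y) η)
    ⟨interp κ Y x, by rintro _ ⟨η, rfl⟩; exact affine_sub_conjOn_le_interp hκ hX Y η hx⟩ η

lemma biconjOn_le_interp (hκ : StrictMono κ) (hX : X ⊆ Set.Icc (κ 0) (κ (Fin.last m)))
    (Y : Fin (m + 1) → ℝ) {x : ℝ} (hx : x ∈ X) :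
    biconjOn X (interp κ Y) x ≤ interp κ Y x :=
  ciSup_le fun η => affine_sub_conjOn_le_interp hκ hX Y η hx

/-- A supremum of affine functions is convex. Only the end points need to lie in `X`, where the
supremum is known to be bounded. -/
lemma biconjOn_combo_le (hκ : StrictMono κ) (hX : X ⊆ Set.Icc (κ 0) (κ (Fin.last m)))
    (Y : Fin (m + 1) → ℝ) {a b s t : ℝ} (ha : a ∈ X) (hb : b ∈ X) (hs : 0 ≤ s) (ht : 0 ≤ t)
    (hst : s + t = 1) :
    biconjOn X (interp κ Y) (s * a + t * b) ≤
      s * biconjOn X (interp κ Y) a + t * biconjOn X (interp κ Y) b := by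
  refine ciSup_le fun η => ?_
  have h1 := mul_le_mul_of_nonneg_left (affine_sub_conjOn_le_biconjOn hκ hX Y η ha) hs
  have h2 := mul_le_mul_of_nonneg_left (affine_sub_conjOn_le_biconjOn hκ hX Y η hb) ht
  obtain rfl : t = 1 - s := by linarith
  linarith

/-- The family `g` omits the basis function of the first knot, so the biconjugate is representable
only if its value there stays equal to `Y 0`. A sufficiently small slope makes the first knot the
maximizer in the conjugate. -/
lemma biconjOn_knot_zero (hκ : StrictMono κ) (hk : ∀ k, κ k ∈ X)
    (hX : X ⊆ Set.Icc (κ 0) (κ (Fin.last m))) (Y : Fin (m + 1) → ℝ) :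
    biconjOn X (interp κ Y) (κ 0) = Y 0 := by
  refine le_antisymm ((biconjOn_le_interp hκ hX Y (hk 0)).trans_eq (interp_knot hκ _ _)) ?_
  -- The index 0 enters with the quotient 0 by the convention for division by zero; this can only
  -- lower the slope, which is harmless.
  obtain ⟨k₀, hmin⟩ := Finite.exists_min fun k => (Y k - Y 0) / (κ k - κ 0)
  set η := (Y k₀ - Y 0) / (κ k₀ - κ 0)
  obtain ⟨k, hc, -⟩ := exists_conjOn_interp_eq hκ hk hX Y η
  refine le_trans ?_ (affine_sub_conjOn_le_biconjOn hκ hX Y η (hk 0))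
  rw [hc]
  rcases eq_or_ne k 0 with rfl | hk0
  · linarith
  · have hpos : 0 < κ k - κ 0 := sub_pos.2 (hκ (Fin.pos_of_ne_zero hk0))
    have := (le_div_iff₀ hpos).1 (hmin k)
    linarith

/-- The biconjugate of a piecewise affine function is piecewise affine with the same knots. -/
lemma biconjOn_eq_interp (hκ : StrictMono κ) (hk : ∀ k, κ k ∈ X)
    (hX : X ⊆ Set.Icc (κ 0) (κ (Fin.last m))) (Y : Fin (m + 1) → ℝ) {x : ℝ} (hx : x ∈ X) :
    biconjOn X (interp κ Y) x = interp κ (fun k => biconjOn X (interp κ Y) (κ k)) x := by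
  rcases exists_segment_weights hκ (hX hx).1 (hX hx).2 with
    ⟨k, rfl⟩ | ⟨j, s, t, hs, ht, hst, rfl, hY⟩
  · rw [interp_knot hκ]
  rw [hY]
  refine le_antisymm (biconjOn_combo_le hκ hX Y (hk _) (hk _) hs ht hst) ?_
  set B := biconjOn X (interp κ Y)
  have hab : κ j.castSucc < κ j.succ := hκ Fin.castSucc_lt_succ
  set a := κ j.castSucc with ha
  set b := κ j.succ with hb
  -- The slope of the chord of `B` over the segment. By convexity `B` lies above this line at every
  -- knot outside the segment, hence so does `Y`. The line is then an affine minorant, and the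
  -- biconjugate dominates it.
  set η := (B b - B a) / (b - a) with hη
  have hηab : η * (b - a) = B b - B a := div_mul_cancel₀ _ (by linarith)
  obtain ⟨k, hc, -⟩ := exists_conjOn_interp_eq hκ hk hX Y η
  have hline : B a + η * (κ k - a) ≤ B (κ k) := by
    obtain h | rfl | rfl | h : k < j.castSucc ∨ k = j.castSucc ∨ k = j.succ ∨ j.succ < k := by
      simp only [Fin.lt_def, Fin.ext_iff, Fin.val_castSucc, Fin.val_succ]
      omega
    · have hlt : κ k < a := hκ h
      have hd : 0 < b - κ k := by linarith
      have key := biconjOn_combo_le hκ hX Y (hk k) (hk j.succ) (s := (b - a) / (b - κ k))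
        (t := (a - κ k) / (b - κ k)) (div_nonneg (by linarith) hd.le)
        (div_nonneg (by linarith) hd.le) (by field_simp; ring)
      rw [← hb, show (b - a) / (b - κ k) * κ k + (a - κ k) / (b - κ k) * b = a by
        field_simp; ring] at key
      change B a ≤ _ * B _ + _ * B _ at key
      rw [div_mul_eq_mul_div, div_mul_eq_mul_div, ← add_div, le_div_iff₀ hd] at key
      have hpos : 0 < b - a := by linarith
      refine le_of_mul_le_mul_left ?_ hpos
      nlinarith
    · simp [← ha]
    · rw [← hb]
      linarith
    · have hlt : b < κ k := hκ h
      have hd : 0 < κ k - a := by linarith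
      have key := biconjOn_combo_le hκ hX Y (hk j.castSucc) (hk k) (s := (κ k - b) / (κ k - a))
        (t := (b - a) / (κ k - a)) (div_nonneg (by linarith) hd.le)
        (div_nonneg (by linarith) hd.le) (by field_simp; ring)
      rw [← ha, show (κ k - b) / (κ k - a) * a + (b - a) / (κ k - a) * κ k = b by
        field_simp; ring] at key
      change B b ≤ _ * B _ + _ * B _ at key
      rw [div_mul_eq_mul_div, div_mul_eq_mul_div, ← add_div, le_div_iff₀ hd] at key
      have hpos : 0 < b - a := by linarith
      refine le_of_mul_le_mul_left ?_ hpos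
      nlinarith
  have hBk : B (κ k) ≤ Y k :=
    (biconjOn_le_interp hκ hX Y (hk k)).trans_eq (interp_knot hκ _ _)
  refine le_trans ?_ (affine_sub_conjOn_le_biconjOn hκ hX Y η hx)
  rw [hc]
  obtain rfl : s = 1 - t := by linarith
  have : t * (η * (b - a)) = t * (B b - B a) := by rw [hηab]
  linarith

end Conj

end TwoStageDRO

namespace TwoStageDRO

/-! ### Linear programming duality -/

/-- **Farkas' lemma** for finitely many linear functionals on a real vector space. -/
theorem farkas {E ι : Type*} [AddCommGroup E] [Module ℝ E] (s : Finset ι)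
    (f : ι → E →ₗ[ℝ] ℝ) (c : E →ₗ[ℝ] ℝ) (h : ∀ x, (∀ i ∈ s, 0 ≤ f i x) → 0 ≤ c x) :
    ∃ p : ι → ℝ, (∀ i, 0 ≤ p i) ∧ c = ∑ i ∈ s, p i • f i := by
  classical
  induction s using Finset.induction_on generalizing f c with
  | empty =>
    refine ⟨0, fun _ => le_rfl, LinearMap.ext fun x => ?_⟩
    have h1 := h x (by simp)
    have h2 := h (-x) (by simp)
    rw [map_neg] at h2
    simpa using le_antisymm (by linarith) h1
  | insert j s hj ih =>
    by_cases hs : ∀ x, (∀ i ∈ s, 0 ≤ f i x) → 0 ≤ c x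
    · obtain ⟨p, hp, hc⟩ := ih f c hs
      refine ⟨Function.update p j 0, fun i => ?_, ?_⟩
      · rcases eq_or_ne i j with rfl | hij
        · simp
        · simpa [hij] using hp i
      · rw [Finset.sum_insert hj, Function.update_self, zero_smul, zero_add, hc]
        refine Finset.sum_congr rfl fun i hi => ?_
        rw [Function.update_of_ne (by rintro rfl; exact hj hi)]
    -- Now `y` satisfies the old constraints but has `c y < 0`, so `f j y < 0`. The map sending `x`
    -- to `(-f j y) • x + f j x • y` lands in the kernel of `f j`; composing `c` and the other
    -- functionals with it removes the constraint `j` and allows induction.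
    · push Not at hs
      obtain ⟨y, hy, hcy⟩ := hs
      have hjy : f j y < 0 := by
        by_contra! hjy
        refine absurd (h y fun i hi => ?_) hcy.not_ge
        rcases Finset.mem_insert.1 hi with rfl | hi
        exacts [hjy, hy i hi]
      obtain ⟨p, hp, hc⟩ := ih (fun i => (-f j y) • f i + f i y • f j) ((-f j y) • c + c y • f j)
        (by
          intro x hx
          have := h ((-f j y) • x + f j x • y) (by
            intro i hi
            rcases Finset.mem_insert.1 hi with rfl | hi
            · simp only [map_add, map_smul, smul_eq_mul]
              linarith
            · have := hx i hi
              simp only [LinearMap.add_apply, LinearMap.smul_apply, smul_eq_mul] at this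
              simp only [map_add, map_smul, smul_eq_mul]
              linarith)
          simp only [map_add, map_smul, smul_eq_mul] at this
          simp only [LinearMap.add_apply, LinearMap.smul_apply, smul_eq_mul]
          linarith)
      -- The multiplier of `f j` is obtained by solving the identity `hc` for `c`.
      have hq : 0 ≤ (∑ i ∈ s, p i * f i y - c y) / (-f j y) := by
        refine div_nonneg ?_ (by linarith)
        have := Finset.sum_nonneg fun i hi => mul_nonneg (hp i) (hy i hi)
        linarith
      refine ⟨Function.update p j ((∑ i ∈ s, p i * f i y - c y) / (-f j y)), fun i => ?_, ?_⟩
      · rcases eq_or_ne i j with rfl | hij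
        · simpa using hq
        · simpa [hij] using hp i
      · rw [Finset.sum_insert hj, Function.update_self]
        have hsum : ∑ i ∈ s, Function.update p j ((∑ i ∈ s, p i * f i y - c y) / (-f j y)) i • f i
            = ∑ i ∈ s, p i • f i := Finset.sum_congr rfl fun i hi => by
          rw [Function.update_of_ne (by rintro rfl; exact hj hi)]
        rw [hsum]
        ext x
        have hx := LinearMap.congr_fun hc x
        simp only [LinearMap.add_apply, LinearMap.smul_apply, LinearMap.sum_apply, smul_eq_mul,
          mul_add, Finset.sum_add_distrib] at hx ⊢
        have e1 : ∑ i ∈ s, p i * (-f j y * f i x) = -f j y * ∑ i ∈ s, p i * f i x := by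
          rw [Finset.mul_sum]
          exact Finset.sum_congr rfl fun i _ => by ring
        have e2 : ∑ i ∈ s, p i * (f i y * f j x) = (∑ i ∈ s, p i * f i y) * f j x := by
          rw [Finset.sum_mul]
          exact Finset.sum_congr rfl fun i _ => by ring
        rw [e1, e2] at hx
        have hne : -f j y ≠ 0 := by linarith
        have hdiv := div_mul_cancel₀ (∑ i ∈ s, p i * f i y - c y) hne
        refine mul_left_cancel₀ hne ?_
        linear_combination hx - hdiv * f j x

/-- **Strong duality** of linear programming, in the form of the existence of multipliers at an
optimizer `x`. -/
theorem exists_lp_multipliers {E ι : Type*} [AddCommGroup E] [Module ℝ E] [Fintype ι]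
    (f : ι → E →ₗ[ℝ] ℝ) (b : ι → ℝ) (c : E →ₗ[ℝ] ℝ) (x : E) (hx : ∀ i, b i ≤ f i x)
    (hopt : ∀ x', (∀ i, b i ≤ f i x') → c x ≤ c x') :
    ∃ p : ι → ℝ, (∀ i, 0 ≤ p i) ∧ c = ∑ i, p i • f i ∧ c x = ∑ i, p i * b i := by
  classical
  -- Only the active constraints enter: a direction nonnegative on them remains feasible for small
  -- positive times, so optimality makes the objective nonnegative on it.
  obtain ⟨p, hp, hc⟩ := farkas (Finset.univ.filter fun i => f i x = b i) f c (by
    intro d hd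
    have hev : ∀ᶠ t : ℝ in nhdsWithin 0 (Set.Ioi 0), ∀ i, b i ≤ f i (x + t • d) := by
      rw [Filter.eventually_all]
      intro i
      rcases (hx i).eq_or_lt with h | h
      · filter_upwards [self_mem_nhdsWithin] with t ht
        have := mul_nonneg (le_of_lt ht) (hd i (by simp [h]))
        rw [map_add, map_smul, smul_eq_mul]
        linarith
      · have hcont : Continuous fun t : ℝ => f i (x + t • d) := by
          simp only [map_add, map_smul, smul_eq_mul]
          fun_prop
        have := (hcont.tendsto 0).eventually (lt_mem_nhds (a := b i) (by simpa using h))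
        exact (this.filter_mono nhdsWithin_le_nhds).mono fun t ht => ht.le
    obtain ⟨t, ht, ht0⟩ := (hev.and self_mem_nhdsWithin).exists
    have := hopt _ ht
    rw [map_add, map_smul, smul_eq_mul] at this
    exact nonneg_of_mul_nonneg_right (by linarith) ht0)
  -- Inactive constraints get multiplier 0. This complementary slackness yields the equality of
  -- values.
  refine ⟨fun i => if f i x = b i then p i else 0, fun i => ?_, ?_, ?_⟩
  · dsimp only
    split_ifs
    exacts [hp i, le_rfl]
  · rw [hc, Finset.sum_filter]
    exact Finset.sum_congr rfl fun i _ => by by_cases h : f i x = b i <;> simp [h]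
  · rw [hc, Finset.sum_filter, LinearMap.sum_apply]
    refine Finset.sum_congr rfl fun i _ => ?_
    split_ifs with h <;> simp [h]

end TwoStageDRO

namespace TwoStageDRO

open Set Data

/-! ### Optimality of comonotone couplings -/

section Transport

variable {Ω : Type*} [MeasurableSpace Ω] {P : Measure Ω} {X Y : Ω → ℝ}

/-- The distance is the length of the interval between the points. Half-open intervals make
membership of `t` a statement about the events `x ≤ t` and `y ≤ t`. -/
lemma ofReal_abs_sub_eq_lintegral (x y : ℝ) :
    ENNReal.ofReal |x - y| =
      ∫⁻ t, ((Ico x y).indicator 1 t + (Ico y x).indicator 1 t) := by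
  rw [lintegral_add_left (measurable_one.indicator measurableSet_Ico),
    lintegral_indicator_one measurableSet_Ico, lintegral_indicator_one measurableSet_Ico,
    Real.volume_Ico, Real.volume_Ico]
  rcases le_total x y with h | h
  · rw [abs_of_nonpos (by linarith), ENNReal.ofReal_of_nonpos (p := x - y) (by linarith), add_zero,
      neg_sub]
  · rw [abs_of_nonneg (by linarith), ENNReal.ofReal_of_nonpos (p := y - x) (by linarith), zero_add]

lemma lintegral_abs_sub_eq [SFinite P] (hX : Measurable X) (hY : Measurable Y) :
    ∫⁻ ω, ENNReal.ofReal |X ω - Y ω| ∂P =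
      ∫⁻ t, (P ({ω | X ω ≤ t} \ {ω | Y ω ≤ t}) + P ({ω | Y ω ≤ t} \ {ω | X ω ≤ t})) := by
  have key : ∀ {X Y : Ω → ℝ}, Measurable X → Measurable Y →
      MeasurableSet {z : Ω × ℝ | z.2 ∈ Ico (X z.1) (Y z.1)} := fun hX hY =>
    (measurableSet_le (hX.comp measurable_fst) measurable_snd).inter
      (measurableSet_lt measurable_snd (hY.comp measurable_fst))
  simp_rw [ofReal_abs_sub_eq_lintegral]
  rw [lintegral_lintegral_swap]
  · refine lintegral_congr fun t => ?_
    have h1 : MeasurableSet ({ω | X ω ≤ t} \ {ω | Y ω ≤ t}) :=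
      (measurableSet_le hX measurable_const).diff (measurableSet_le hY measurable_const)
    have h2 : MeasurableSet ({ω | Y ω ≤ t} \ {ω | X ω ≤ t}) :=
      (measurableSet_le hY measurable_const).diff (measurableSet_le hX measurable_const)
    rw [← lintegral_indicator_one h1, ← lintegral_indicator_one h2,
      ← lintegral_add_left (measurable_one.indicator h1)]
    refine lintegral_congr fun ω => ?_
    simp [indicator, not_le]
  · refine Measurable.aemeasurable ?_
    exact (measurable_one.indicator (key hX hY)).add (measurable_one.indicator (key hY hX))

/-- At each level `t` nestedness makes the symmetric difference of the sublevel sets as small as the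
marginals permit: its mass is the difference of the two distribution functions, a lower bound for
every coupling. -/
lemma lintegral_abs_sub_le_W1 [IsFiniteMeasure P] (hX : Measurable X) (hY : Measurable Y)
    (h : ∀ t, {ω | X ω ≤ t} ⊆ {ω | Y ω ≤ t} ∨ {ω | Y ω ≤ t} ⊆ {ω | X ω ≤ t}) :
    ∫⁻ ω, ENNReal.ofReal |X ω - Y ω| ∂P ≤ W1 (P.map X) (P.map Y) := by
  refine le_iInf₂ fun γ hγ => ?_
  obtain ⟨h1, h2⟩ := hγ
  -- Finiteness is not part of the definition of `W1`; the total mass is read off from the first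
  -- marginal and is needed for Tonelli.
  have : IsFiniteMeasure γ := ⟨by
    have := congrArg (fun ν : Measure ℝ => ν univ) h1
    simp only [Measure.map_apply measurable_fst MeasurableSet.univ, preimage_univ] at this
    rw [this]
    exact measure_lt_top _ _⟩
  rw [lintegral_abs_sub_eq hX hY, lintegral_abs_sub_eq measurable_fst measurable_snd]
  refine lintegral_mono fun t => ?_
  have hXt : MeasurableSet {ω | X ω ≤ t} := measurableSet_le hX measurable_const
  have hYt : MeasurableSet {ω | Y ω ≤ t} := measurableSet_le hY measurable_const
  have e1 : γ {z | z.1 ≤ t} = P {ω | X ω ≤ t} := by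
    have := congrArg (fun ν : Measure ℝ => ν (Iic t)) h1
    simp only [Measure.map_apply measurable_fst measurableSet_Iic,
      Measure.map_apply hX measurableSet_Iic] at this
    exact this
  have e2 : γ {z | z.2 ≤ t} = P {ω | Y ω ≤ t} := by
    have := congrArg (fun ν : Measure ℝ => ν (Iic t)) h2
    simp only [Measure.map_apply measurable_snd measurableSet_Iic,
      Measure.map_apply hY measurableSet_Iic] at this
    exact this
  rcases h t with h | h
  · rw [sdiff_eq_empty.2 h, measure_empty, zero_add,
      measure_sdiff h hXt.nullMeasurableSet (measure_ne_top _ _), ← e1, ← e2]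
    exact le_measure_sdiff.trans le_add_self
  · rw [sdiff_eq_empty.2 h, measure_empty, add_zero,
      measure_sdiff h hYt.nullMeasurableSet (measure_ne_top _ _), ← e1, ← e2]
    exact le_measure_sdiff.trans le_self_add

/-- The product coupling suffices. The bound keeps `W1bar` finite, so that its `toReal` is not the
default value 0. -/
lemma W1_le_of_bounded {S : Set ℝ} {R : ℝ} (hR : ∀ x ∈ S, ∀ y ∈ S, |x - y| ≤ R) {μ ν : Measure ℝ}
    (hμ : IsProbOn S μ) (hν : IsProbOn S ν) : W1 μ ν ≤ ENNReal.ofReal R := by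
  have := hμ.1
  have := hν.1
  refine (iInf₂_le (μ.prod ν) ⟨by simp, by simp⟩).trans ?_
  have hae : ∀ᵐ z ∂(μ.prod ν), ENNReal.ofReal |z.1 - z.2| ≤ ENNReal.ofReal R := by
    have h1 : ∀ᵐ z ∂(μ.prod ν), z.1 ∈ S :=
      Measure.quasiMeasurePreserving_fst.ae (p := fun x => x ∈ S) hμ.2
    have h2 : ∀ᵐ z ∂(μ.prod ν), z.2 ∈ S :=
      Measure.quasiMeasurePreserving_snd.ae (p := fun x => x ∈ S) hν.2
    filter_upwards [h1, h2] with z hz1 hz2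
    exact ENNReal.ofReal_le_ofReal (hR _ hz1 _ hz2)
  refine (lintegral_mono_ae hae).trans ?_
  simp

lemma integral_abs_sub_le_W1bar {S : Set ℝ} {G : Set (ℝ → ℝ)} (hS : Bornology.IsBounded S)
    {μ : Measure ℝ} (hμ : IsProbOn S μ) [IsFiniteMeasure P] (hX : Measurable X)
    (hY : Measurable Y) (hXG : P.map X ∈ momentSet S G μ) (hYμ : P.map Y = μ)
    (h : ∀ t, {ω | X ω ≤ t} ⊆ {ω | Y ω ≤ t} ∨ {ω | Y ω ≤ t} ⊆ {ω | X ω ≤ t}) :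
    ∫ ω, |X ω - Y ω| ∂P ≤ (W1bar S G μ).toReal := by
  obtain ⟨R, hR⟩ := Metric.isBounded_iff.1 hS
  have hfin : W1bar S G μ ≠ ∞ := by
    refine ne_top_of_le_ne_top ENNReal.ofReal_ne_top (b := ENNReal.ofReal R)
      (iSup₂_le fun ν hν => ?_)
    exact W1_le_of_bounded (fun x hx y hy => (Real.dist_eq x y).symm.trans_le (hR hx hy)) hμ hν.1
  rw [integral_eq_lintegral_of_nonneg_ae (ae_of_all _ fun ω => abs_nonneg _)
    (Measurable.aestronglyMeasurable (f := fun ω => |X ω - Y ω|)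
      (continuous_abs.measurable.comp (hX.sub hY)))]
  refine ENNReal.toReal_mono hfin ?_
  simp_rw [abs_sub_comm (X _)]
  refine (lintegral_abs_sub_le_W1 hY hX fun t => (h t).symm).trans ?_
  rw [hYμ]
  exact le_iSup₂ (f := fun ν (_ : ν ∈ momentSet S G μ) => W1 μ ν) _ hXG

end Transport

/-! ### The quantile transform -/

section Quantile

variable {S : Set ℝ} {μ : Measure ℝ}

lemma IsProbOn.nonempty (hμ : IsProbOn S μ) : S.Nonempty := by
  rw [nonempty_iff_ne_empty]
  rintro rfl
  have := hμ.1
  simpa using hμ.2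

lemma IsProbOn.real_inter_Iic (hμ : IsProbOn S μ) (x : ℝ) :
    μ.real (S ∩ Iic x) = μ.real (Iic x) := by
  rw [measureReal_def, measureReal_def, inter_comm, measure_inter_conull hμ.2]

/-- The infimum is attained because `S` is closed and the distribution function is right continuous.
The condition `t ≤ 1` makes the maximum of `S` a member of the set. -/
lemma isLeast_quantile (hS : IsCompact S) (hμ : IsProbOn S μ) {t : ℝ} (ht : t ≤ 1) :
    IsLeast {x | x ∈ S ∧ t ≤ μ.real (S ∩ Iic x)} (quantile S μ t) := by
  have := hμ.1
  set A := {x | x ∈ S ∧ t ≤ μ.real (S ∩ Iic x)} with hA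
  have hne : A.Nonempty := by
    obtain ⟨M, hM⟩ := hS.exists_isGreatest hμ.nonempty
    refine ⟨M, hM.1, ht.trans_eq ?_⟩
    rw [inter_eq_left.2 (show S ⊆ Iic M from fun x hx => hM.2 hx), measureReal_def,
      (prob_compl_eq_zero_iff hS.measurableSet).1 hμ.2, ENNReal.toReal_one]
  have hbdd : BddBelow A := hS.bddBelow.mono fun x hx => hx.1
  refine ⟨⟨hS.isClosed.closure_subset_iff.2 (fun x hx => hx.1) (csInf_mem_closure hne hbdd), ?_⟩,
    fun x hx => csInf_le hbdd hx⟩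
  obtain ⟨x, -, hx, hxA⟩ := exists_seq_tendsto_sInf hne hbdd
  have hcont := (cdf μ).right_continuous (sInf A)
  have hlim : Filter.Tendsto (fun n => cdf μ (x n)) Filter.atTop (nhds (cdf μ (sInf A))) :=
    hcont.tendsto.comp (tendsto_nhdsWithin_iff.2
      ⟨hx, Filter.Eventually.of_forall fun n => csInf_le hbdd (hxA n)⟩)
  rw [quantile, hμ.real_inter_Iic, ← cdf_eq_real]
  refine ge_of_tendsto' hlim fun n => ?_
  rw [cdf_eq_real, ← hμ.real_inter_Iic]
  exact (hxA n).2

lemma quantile_mem (hS : IsCompact S) (hμ : IsProbOn S μ) {t : ℝ} (ht : t ≤ 1) :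
    quantile S μ t ∈ S :=
  (isLeast_quantile hS hμ ht).1.1

lemma quantile_mono (hS : IsCompact S) (hμ : IsProbOn S μ) {s t : ℝ} (hst : s ≤ t) (ht : t ≤ 1) :
    quantile S μ s ≤ quantile S μ t :=
  (isLeast_quantile hS hμ (hst.trans ht)).2
    ⟨quantile_mem hS hμ ht, hst.trans (isLeast_quantile hS hμ ht).1.2⟩

lemma le_of_quantile_le (hS : IsCompact S) (hμ : IsProbOn S μ) {t x : ℝ} (ht : t ≤ 1)
    (h : quantile S μ t ≤ x) : t ≤ μ.real (Iic x) := by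
  have := hμ.1
  refine (isLeast_quantile hS hμ ht).1.2.trans ?_
  rw [hμ.real_inter_Iic]
  exact measureReal_mono (Iic_subset_Iic.2 h)

/-- Positivity of `t` is essential: at `t = 0` the quantile is the least point of `S`, whatever `x`
is. -/
lemma quantile_le (hS : IsCompact S) (hμ : IsProbOn S μ) {t x : ℝ} (h0 : 0 < t) (ht : t ≤ 1)
    (h : t ≤ μ.real (Iic x)) : quantile S μ t ≤ x := by
  have hne : (S ∩ Iic x).Nonempty := by
    rw [nonempty_iff_ne_empty]
    intro he
    have := hμ.real_inter_Iic x
    rw [he, measureReal_empty] at this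
    linarith
  obtain ⟨y, hy⟩ := (hS.inter_right isClosed_Iic).exists_isGreatest hne
  refine ((isLeast_quantile hS hμ ht).2 ⟨hy.1.1, h.trans_eq ?_⟩).trans hy.1.2
  rw [← hμ.real_inter_Iic]
  congr 1
  ext z
  exact ⟨fun hz => ⟨hz.1, hy.2 hz⟩, fun hz => ⟨hz.1, (show z ≤ y from hz.2).trans hy.1.2⟩⟩

variable {Ω : Type*} [MeasurableSpace Ω] {P : Measure Ω} {U : Ω → ℝ}

lemma measurable_quantile_comp (hS : IsCompact S) (hμ : IsProbOn S μ) (hU : Measurable U)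
    (hU01 : ∀ ω, U ω ∈ Icc (0 : ℝ) 1) : Measurable fun ω => quantile S μ (U ω) := by
  -- Truncation is needed because above 1 the defining set is empty and `sInf` returns 0, which
  -- breaks monotonicity.
  have hmono : Monotone fun t => quantile S μ (min t 1) := fun s t hst =>
    quantile_mono hS hμ (min_le_min_right _ hst) (min_le_right _ _)
  have heq : (fun ω => quantile S μ (U ω)) = (fun t => quantile S μ (min t 1)) ∘ U := by
    ext ω
    simp [min_eq_left (hU01 ω).2]
  rw [heq]
  exact hmono.measurable.comp hU

lemma map_quantile_comp [IsProbabilityMeasure P] (hS : IsCompact S) (hμ : IsProbOn S μ)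
    (hU : Measurable U) (hU01 : ∀ ω, U ω ∈ Icc (0 : ℝ) 1)
    (hunif : ∀ t ∈ Icc (0 : ℝ) 1, P.real {ω | U ω ≤ t} = t) :
    P.map (fun ω => quantile S μ (U ω)) = μ := by
  have := hμ.1
  have hm := measurable_quantile_comp hS hμ hU hU01
  have := Measure.isProbabilityMeasure_map (μ := P) hm.aemeasurable
  refine Measure.eq_of_cdf _ _ (StieltjesFunction.ext fun x => ?_)
  rw [cdf_eq_real, cdf_eq_real, map_measureReal_apply hm measurableSet_Iic]
  have h01 : μ.real (Iic x) ∈ Icc (0 : ℝ) 1 := ⟨measureReal_nonneg, measureReal_le_one⟩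
  refine le_antisymm ?_ ?_
  · rw [← hunif _ h01]
    exact measureReal_mono fun ω hω => le_of_quantile_le hS hμ (hU01 ω).2 hω
  · have h0 := hunif 0 ⟨le_rfl, zero_le_one⟩
    calc μ.real (Iic x) = P.real {ω | U ω ≤ μ.real (Iic x)} := (hunif _ h01).symm
      _ ≤ P.real ((fun ω => quantile S μ (U ω)) ⁻¹' Iic x ∪ {ω | U ω ≤ 0}) := by
        refine measureReal_mono fun ω hω => ?_
        rcases le_or_gt (U ω) 0 with h | h
        · exact Or.inr h
        · exact Or.inl (quantile_le hS hμ h (hU01 ω).2 hω)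
      _ ≤ _ := (measureReal_union_le _ _).trans_eq (by rw [h0, add_zero])

end Quantile

/-! ### Distributional transform of a ranked discrete variable -/

section CumWeight

variable {J : ℕ} {α : Fin J → ℝ} {σ : Equiv.Perm (Fin J)}

lemma cumWeight_zero : cumWeight α σ 0 = 0 := by simp [cumWeight]

lemma cumWeight_last : cumWeight α σ J = ∑ j, α j :=
  Finset.sum_congr rfl fun j _ => if_pos (σ j).2

lemma cumWeight_mono (hα : ∀ j, 0 ≤ α j) : Monotone (cumWeight α σ) := by
  intro k l hkl
  refine Finset.sum_le_sum fun j _ => ?_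
  split_ifs with h1 h2
  exacts [le_rfl, absurd (h1.trans hkl) h2, hα j, le_rfl]

/-- Values of `σ` count from 0 and levels from 1, so passing from level `σ j` to the next admits
exactly the atom `j`. -/
lemma cumWeight_succ (j : Fin J) :
    cumWeight α σ ((σ j : ℕ) + 1) = cumWeight α σ (σ j : ℕ) + α j := by
  rw [cumWeight, cumWeight, ← sub_eq_iff_eq_add', ← Finset.sum_sub_distrib,
    Finset.sum_eq_single j]
  · simp
  · intro l _ hl
    have : (σ l : ℕ) ≠ σ j := fun h => hl (σ.injective (Fin.ext h))
    by_cases h : (σ l : ℕ) + 1 ≤ σ j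
    · rw [if_pos h, if_pos (by omega), sub_self]
    · rw [if_neg h, if_neg (by omega), sub_self]
  · simp

lemma cumWeight_mem_Icc (hα : ∀ j, 0 ≤ α j) (h1 : ∑ j, α j = 1) {l : ℕ} (hl : l ≤ J) :
    cumWeight α σ l ∈ Icc (0 : ℝ) 1 := by
  constructor
  · rw [← cumWeight_zero (α := α) (σ := σ)]
    exact cumWeight_mono hα (Nat.zero_le _)
  · rw [← h1, ← cumWeight_last (α := α) (σ := σ)]
    exact cumWeight_mono hα hl

variable {Ω : Type*} {Z : Ω → Fin J} {C : Ω → ℝ}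

/-- The distributional transform of the rank of `Z`, randomized by `C`. -/
noncomputable def rankTransform (α : Fin J → ℝ) (σ : Equiv.Perm (Fin J)) (Z : Ω → Fin J) (C : Ω → ℝ) (ω : Ω) :
    ℝ :=
  C ω * cumWeight α σ ((σ (Z ω) : ℕ) + 1) + (1 - C ω) * cumWeight α σ (σ (Z ω) : ℕ)

lemma rankTransform_eq (ω : Ω) :
    rankTransform α σ Z C ω = C ω * α (Z ω) + cumWeight α σ (σ (Z ω) : ℕ) := by
  rw [rankTransform, cumWeight_succ]
  ring

lemma cumWeight_le_rankTransform (hα : ∀ j, 0 ≤ α j) (hC : ∀ ω, C ω ∈ Icc (0 : ℝ) 1) (ω : Ω) :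
    cumWeight α σ (σ (Z ω) : ℕ) ≤ rankTransform α σ Z C ω := by
  rw [rankTransform_eq]
  linarith [mul_nonneg (hC ω).1 (hα (Z ω))]

lemma rankTransform_le_cumWeight (hα : ∀ j, 0 ≤ α j) (hC : ∀ ω, C ω ∈ Icc (0 : ℝ) 1) (ω : Ω) :
    rankTransform α σ Z C ω ≤ cumWeight α σ ((σ (Z ω) : ℕ) + 1) := by
  rw [rankTransform_eq, cumWeight_succ]
  linarith [mul_le_mul_of_nonneg_right (hC ω).2 (hα (Z ω))]

lemma rankTransform_mem_Icc (hα : ∀ j, 0 ≤ α j) (h1 : ∑ j, α j = 1)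
    (hC : ∀ ω, C ω ∈ Icc (0 : ℝ) 1) (ω : Ω) : rankTransform α σ Z C ω ∈ Icc (0 : ℝ) 1 :=
  ⟨(cumWeight_mem_Icc hα h1 (σ (Z ω)).2.le).1.trans (cumWeight_le_rankTransform hα hC ω),
    (rankTransform_le_cumWeight hα hC ω).trans (cumWeight_mem_Icc hα h1 (σ (Z ω)).2).2⟩

lemma rankTransform_le_of_rank_lt (hα : ∀ j, 0 ≤ α j) (hC : ∀ ω, C ω ∈ Icc (0 : ℝ) 1) {ω ω' : Ω}
    (h : σ (Z ω) < σ (Z ω')) : rankTransform α σ Z C ω ≤ rankTransform α σ Z C ω' :=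
  (rankTransform_le_cumWeight hα hC ω).trans
    ((cumWeight_mono hα h).trans (cumWeight_le_rankTransform hα hC ω'))

variable [MeasurableSpace Ω] {P : Measure Ω}

lemma measurable_rankTransform (hZ : Measurable Z) (hC : Measurable C) :
    Measurable (rankTransform α σ Z C) := by
  have h : ∀ f : Fin J → ℝ, Measurable fun ω => f (Z ω) := fun f =>
    (measurable_of_finite f).comp hZ
  exact (hC.mul (h fun j => cumWeight α σ ((σ j : ℕ) + 1))).add
    ((measurable_const.sub hC).mul (h fun j => cumWeight α σ (σ j : ℕ)))

lemma measureReal_le_of_uniform (hC : Measurable C)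
    (hunif : P.map C = volume.restrict (Icc (0 : ℝ) 1)) (s : ℝ) :
    P.real (C ⁻¹' Iic s) = max (min s 1) 0 := by
  have : P (C ⁻¹' Iic s) = volume.restrict (Icc (0 : ℝ) 1) (Iic s) := by
    rw [← hunif, Measure.map_apply hC measurableSet_Iic]
  rw [measureReal_def, this, Measure.restrict_apply measurableSet_Iic,
    show Iic s ∩ Icc (0 : ℝ) 1 = Icc 0 (min s 1) by ext; simp; tauto, Real.volume_Icc, sub_zero,
    ENNReal.toReal_ofReal']

/-- Given `Z = j`, the transform is uniform on an interval of length `α j` starting at the weight of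
the lower ranks. These intervals tile `[0, 1]`, so the mixture is uniform. -/
lemma measureReal_rankTransform_le [IsProbabilityMeasure P] (hα : ∀ j, 0 < α j)
    (h1 : ∑ j, α j = 1) (hZ : Measurable Z) (hZα : ∀ j, P.real {ω | Z ω = j} = α j)
    (hC : Measurable C) (hunif : P.map C = volume.restrict (Icc (0 : ℝ) 1))
    (hind : IndepFun C Z P) {t : ℝ} (ht : t ∈ Icc (0 : ℝ) 1) :
    P.real {ω | rankTransform α σ Z C ω ≤ t} = t := by
  have hterm : ∀ j, P.real ({ω | rankTransform α σ Z C ω ≤ t} ∩ Z ⁻¹' {j}) =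
      min t (cumWeight α σ ((σ j : ℕ) + 1)) - min t (cumWeight α σ (σ j : ℕ)) := by
    intro j
    have hset : {ω | rankTransform α σ Z C ω ≤ t} ∩ Z ⁻¹' {j} =
        C ⁻¹' Iic ((t - cumWeight α σ (σ j : ℕ)) / α j) ∩ Z ⁻¹' {j} := by
      ext ω
      simp only [mem_inter_iff, mem_ofPred_eq, mem_preimage, mem_singleton_iff, mem_Iic,
        and_congr_left_iff]
      rintro rfl
      rw [rankTransform_eq, le_div_iff₀ (hα _), le_sub_iff_add_le]
    have hZj : P.real (Z ⁻¹' {j}) = α j := hZα j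
    rw [hset, measureReal_def, hind.measure_inter_preimage_eq_mul _ _ measurableSet_Iic
      (measurableSet_singleton j), ENNReal.toReal_mul, ← measureReal_def, ← measureReal_def, hZj]
    rw [measureReal_le_of_uniform hC hunif, max_mul_of_nonneg _ _ (hα j).le, min_mul_of_nonneg _ _ (hα j).le,
      div_mul_cancel₀ _ (hα j).ne', cumWeight_succ, zero_mul, one_mul]
    have := hα j
    rcases le_total t (cumWeight α σ (σ j : ℕ)) with h | h
    · rw [min_eq_left h, min_eq_left (by linarith), min_eq_left (by linarith),
        max_eq_right (by linarith), sub_self]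
    · rw [min_eq_right h]
      rcases le_total t (cumWeight α σ (σ j : ℕ) + α j) with h' | h'
      · rw [min_eq_left h', min_eq_left (by linarith), max_eq_left (by linarith)]
      · rw [min_eq_right h', min_eq_right (by linarith), max_eq_left (by linarith)]
        ring
  have hdecomp : P.real {ω | rankTransform α σ Z C ω ≤ t} =
      ∑ j, P.real ({ω | rankTransform α σ Z C ω ≤ t} ∩ Z ⁻¹' {j}) := by
    rw [← measureReal_biUnion_finset]
    · congr 1
      ext ω
      simp
    · intro j _ l _ hjl
      refine disjoint_left.2 fun ω h h' => hjl ?_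
      exact h.2.symm.trans h'.2
    · exact fun j _ => (measurableSet_le (measurable_rankTransform hZ hC) measurable_const).inter
        (hZ (measurableSet_singleton j))
  -- Reindexed by rank, the sum telescopes.
  rw [hdecomp, Finset.sum_congr rfl fun j _ => hterm j,
    Equiv.sum_comp σ fun l : Fin J => min t (cumWeight α σ ((l : ℕ) + 1)) -
      min t (cumWeight α σ (l : ℕ)),
    Fin.sum_univ_eq_sum_range (fun l => min t (cumWeight α σ (l + 1)) - min t (cumWeight α σ l)),
    Finset.sum_range_sub fun l => min t (cumWeight α σ l), cumWeight_last, cumWeight_zero, h1,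
    min_eq_left ht.2, min_eq_right ht.1, sub_zero]

end CumWeight

end TwoStageDRO

namespace TwoStageDRO

open Set

lemma IsPolytope.isCompact {n : ℕ} {S : Set (Fin n → ℝ)} (hS : IsPolytope S) : IsCompact S := by
  obtain ⟨⟨r, A, d, rfl⟩, hb⟩ := hS
  refine Metric.isCompact_of_isClosed_isBounded ?_ hb
  exact isClosed_le (Continuous.matrix_mulVec continuous_const continuous_id) continuous_const

namespace Data

variable {N K₁ nin neq K₂ : ℕ} {D : Data N K₁ nin neq K₂}

/-! ### The spaces and the test functions -/

lemma Assumptions.isCompact_S₂ (hD : D.Assumptions) : IsCompact D.S₂ :=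
  hD.S₂_polytope.isCompact

lemma isCompact_X (i : Fin N) : IsCompact (D.X i) :=
  isCompact_iUnion fun _ => isCompact_Icc

lemma isCompact_XX : IsCompact D.XX := by
  have : D.XX = Set.pi univ D.X := by ext x; simp [XX]
  rw [this]
  exact isCompact_univ_pi isCompact_X

lemma Assumptions.X_subset_Icc (hD : D.Assumptions) (i : Fin N) :
    D.X i ⊆ Icc (D.knot i 0) (D.knot i (Fin.last _)) := by
  intro x hx
  obtain ⟨l, hl⟩ := mem_iUnion.1 hx
  obtain ⟨⟨k, hk⟩, k', hk'⟩ := hD.endpoint_mem i l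
  exact ⟨((hD.knot_strictMono i).monotone (Fin.zero_le k)).trans (hk.trans_le hl.1),
    (hl.2.trans_eq hk'.symm).trans ((hD.knot_strictMono i).monotone (Fin.le_last k'))⟩

lemma u_eq_interp (i : Fin N) (y : Fin (D.m i) → ℝ) :
    D.u i y = interp (D.knot i) (Fin.cons 0 y) := by
  ext x
  simp [interp, Fin.sum_univ_succ, u, g, g₀]

lemma conj_eq_conjOn (i : Fin N) (y : Fin (D.m i) → ℝ) :
    D.conj i y = conjOn (D.X i) (interp (D.knot i) (Fin.cons 0 y)) := by
  ext η
  rw [conj, conjOn, u_eq_interp]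

lemma biconj_eq_biconjOn (i : Fin N) (y : Fin (D.m i) → ℝ) :
    D.biconj i y = biconjOn (D.X i) (interp (D.knot i) (Fin.cons 0 y)) := by
  ext x
  rw [biconj, biconjOn, conj_eq_conjOn]

lemma Assumptions.affine_sub_conj_le_biconj (hD : D.Assumptions) (i : Fin N)
    (y : Fin (D.m i) → ℝ) (η : ℝ) {x : ℝ} (hx : x ∈ D.X i) :
    η * x - D.conj i y η ≤ D.biconj i y x := by
  rw [conj_eq_conjOn, biconj_eq_biconjOn]
  exact affine_sub_conjOn_le_biconjOn (hD.knot_strictMono i) (hD.X_subset_Icc i) _ η hx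

lemma Assumptions.conj_eq_of_isMax (hD : D.Assumptions) (i : Fin N) (y : Fin (D.m i) → ℝ)
    (η : ℝ) {x : ℝ} (hx : x ∈ range (D.knot i))
    (hmax : ∀ x' ∈ range (D.knot i), η * x' - D.u i y x' ≤ η * x - D.u i y x) :
    D.conj i y η = η * x - D.u i y x := by
  obtain ⟨k, rfl⟩ := hx
  have hκ := hD.knot_strictMono i
  rw [conj_eq_conjOn]
  rw [u_eq_interp] at hmax ⊢
  obtain ⟨l, hl, hl'⟩ := exists_conjOn_interp_eq hκ (hD.knot_mem i) (hD.X_subset_Icc i)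
    (Fin.cons 0 y) η
  refine le_antisymm ?_ (affine_sub_le_conjOn hκ (hD.X_subset_Icc i) _ _ (hD.knot_mem i k))
  rw [hl]
  have := hmax _ ⟨l, rfl⟩
  rwa [interp_knot hκ] at this

lemma continuous_g (i : Fin N) (j : Fin (D.m i)) : Continuous (D.g i j) :=
  continuous_cpwa (κ := D.knot i) j.succ

lemma continuous_u (i : Fin N) (y : Fin (D.m i) → ℝ) : Continuous (D.u i y) :=
  continuous_finsetSum _ fun j _ => continuous_const.mul (continuous_g i j)

lemma continuous_conj (i : Fin N) (y : Fin (D.m i) → ℝ) : Continuous (D.conj i y) := by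
  refine (isCompact_X i).continuous_sSup (f := fun η x => η * x - D.u i y x) ?_
  exact (continuous_fst.mul continuous_snd).sub ((continuous_u i y).comp continuous_snd)

lemma Assumptions.v_nonneg (hD : D.Assumptions) (i : Fin N) (j : Fin (D.m i)) : 0 ≤ D.v i j :=
  integral_nonneg fun x => cpwa_nonneg (hD.knot_strictMono i) j.succ x

/-- The coefficients are the values of the biconjugate at the knots; the one at the first knot is 0,
so the omitted basis function is not missed. -/
lemma Assumptions.exists_biconj_coef (hD : D.Assumptions) (i : Fin N) (y : Fin (D.m i) → ℝ) :
    ∃ y' ≤ y, ∀ x ∈ D.X i, D.u i y' x = D.biconj i y x := by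
  have hκ := hD.knot_strictMono i
  refine ⟨fun j => D.biconj i y (D.knot i j.succ), fun j => ?_, fun x hx => ?_⟩
  · rw [biconj_eq_biconjOn]
    refine (biconjOn_le_interp hκ (hD.X_subset_Icc i) _ (hD.knot_mem i _)).trans_eq ?_
    rw [interp_knot hκ, Fin.cons_succ]
  · rw [u_eq_interp, biconj_eq_biconjOn,
      biconjOn_eq_interp hκ (hD.knot_mem i) (hD.X_subset_Icc i) _ hx]
    congr 1
    ext k
    refine Fin.cases ?_ (fun j => ?_) k
    · rw [Fin.cons_zero, biconjOn_knot_zero hκ (hD.knot_mem i) (hD.X_subset_Icc i), Fin.cons_zero]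
    · rw [Fin.cons_succ]

/-! ### The relaxation and its dual -/

/-- The slack of the cut `z` at the variable `w` of the relaxation. -/
noncomputable def slack (D : Data N K₁ nin neq K₂) (z : D.Point) (w : (Fin K₁ → ℝ) × ℝ × D.Coef) : ℝ :=
  w.2.1 + (∑ i, D.u i (w.2.2 i) (z.1 i)) - (D.Vᵀ *ᵥ z.2) ⬝ᵥ w.1 - (D.W *ᵥ z.1 + D.b) ⬝ᵥ z.2

lemma continuous_slack : Continuous fun q : D.Point × ((Fin K₁ → ℝ) × ℝ × D.Coef) =>
    D.slack q.1 q.2 := by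
  have h : ∀ i j, Continuous fun q : D.Point × ((Fin K₁ → ℝ) × ℝ × D.Coef) =>
      D.g i j (q.1.1 i) := fun i j => (continuous_g i j).comp (by fun_prop)
  unfold slack u
  fun_prop

lemma mem_relaxFeasible {cuts : Set D.Point} {w : (Fin K₁ → ℝ) × ℝ × D.Coef} :
    w ∈ D.relaxFeasible cuts ↔ (∀ z ∈ cuts, 0 ≤ D.slack z w) ∧ w.1 ∈ D.S₁ := by
  simp only [relaxFeasible, slack, sub_nonneg, S₁, mem_ofPred_eq]

lemma relaxFeasible_antitone {cuts cuts' : Set D.Point} (h : cuts ⊆ cuts') :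
    D.relaxFeasible cuts' ⊆ D.relaxFeasible cuts := fun _ hw =>
  ⟨fun z hz => hw.1 z (h hz), hw.2⟩

lemma continuous_relaxObj : Continuous D.relaxObj := by
  unfold relaxObj
  fun_prop

lemma isClosed_S₁ : IsClosed D.S₁ :=
  (isClosed_le (Continuous.matrix_mulVec continuous_const continuous_id) continuous_const).inter
    (isClosed_eq (Continuous.matrix_mulVec continuous_const continuous_id) continuous_const)

lemma isClosed_relaxFeasible (cuts : Set D.Point) : IsClosed (D.relaxFeasible cuts) := by
  have : D.relaxFeasible cuts = (⋂ z ∈ cuts, {w | 0 ≤ D.slack z w}) ∩ Prod.fst ⁻¹' D.S₁ := by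
    ext w
    rw [mem_relaxFeasible]
    simp
  rw [this]
  refine IsClosed.inter (isClosed_biInter fun z _ => isClosed_le continuous_const ?_)
    (isClosed_S₁.preimage continuous_fst)
  exact continuous_slack.comp (Continuous.prodMk_right z)

/-- Some variable is feasible for all cuts simultaneously. -/
lemma Assumptions.exists_feasible (hD : D.Assumptions) :
    ∃ w, w ∈ D.relaxFeasible {z | z.1 ∈ D.XX ∧ z.2 ∈ D.S₂} := by
  obtain ⟨a, ha⟩ := hD.S₁_nonempty
  have hc : Continuous fun z : D.Point => D.slack z (a, 0, 0) :=
    continuous_slack.comp (Continuous.prodMk_left _)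
  obtain ⟨M, hM⟩ := (isCompact_XX.prod hD.isCompact_S₂).bddBelow_image hc.continuousOn
  refine ⟨(a, -M, 0), mem_relaxFeasible.2 ⟨fun z hz => ?_, ha⟩⟩
  have := hM ⟨z, hz, rfl⟩
  simp only [slack] at this ⊢
  linarith

lemma exists_isRelaxOptimizer {cuts : Finset D.Point}
    (hbdd : D.BoundedSublevel (cuts : Set D.Point))
    (hne : (D.relaxFeasible (cuts : Set D.Point)).Nonempty) : ∃ w, D.IsRelaxOptimizer cuts w := by
  obtain ⟨w₀, hw₀⟩ := hne
  have hK : IsCompact {w | w ∈ D.relaxFeasible (cuts : Set D.Point) ∧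
      D.relaxObj w ≤ D.relaxObj w₀} :=
    Metric.isCompact_of_isClosed_isBounded ((isClosed_relaxFeasible _).inter
      (isClosed_le continuous_relaxObj continuous_const)) (hbdd _)
  obtain ⟨w, hw, hmin⟩ := hK.exists_isMinOn ⟨w₀, hw₀, le_rfl⟩ continuous_relaxObj.continuousOn
  refine ⟨w, hw.1, fun w' hw' => ?_⟩
  rcases le_total (D.relaxObj w') (D.relaxObj w₀) with h | h
  · exact hmin ⟨hw', h⟩
  · exact hw.2.trans h

lemma dotProduct_mulVec_eq {m n : ℕ} (M : Matrix (Fin m) (Fin n) ℝ) (x : Fin m → ℝ)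
    (y : Fin n → ℝ) : x ⬝ᵥ (M *ᵥ y) = (Mᵀ *ᵥ x) ⬝ᵥ y := by
  rw [dotProduct_mulVec, mulVec_transpose]

lemma DualFeasible.c₁_dotProduct {cuts : Finset D.Point} {ξin : Fin nin → ℝ}
    {ξeq : Fin neq → ℝ} {p : D.Point → ℝ} (h : D.DualFeasible cuts ξin ξeq p) (a : Fin K₁ → ℝ) :
    D.c₁ ⬝ᵥ a = ξin ⬝ᵥ (D.Lin *ᵥ a) + ξeq ⬝ᵥ (D.Leq *ᵥ a) -
      ∑ z ∈ cuts, p z * ((D.Vᵀ *ᵥ z.2) ⬝ᵥ a) := by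
  rw [← h.1, sub_dotProduct, add_dotProduct, sum_dotProduct, dotProduct_mulVec_eq,
    dotProduct_mulVec_eq]
  simp only [smul_dotProduct, smul_eq_mul]

/-- Dual feasibility says that the Lagrangian has matching coefficients in `a`, `y₀` and `y`; weak
duality is then a matter of signs. -/
lemma DualFeasible.relaxObj_eq {cuts : Finset D.Point} {ξin : Fin nin → ℝ} {ξeq : Fin neq → ℝ}
    {p : D.Point → ℝ} (h : D.DualFeasible cuts ξin ξeq p) (w : (Fin K₁ → ℝ) × ℝ × D.Coef) :
    D.relaxObj w = ∑ z ∈ cuts, p z * D.slack z w +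
      ∑ z ∈ cuts, p z * ((D.W *ᵥ z.1 + D.b) ⬝ᵥ z.2) +
      ξin ⬝ᵥ (D.Lin *ᵥ w.1) + ξeq ⬝ᵥ (D.Leq *ᵥ w.1) := by
  have hy : ∑ z ∈ cuts, p z * ∑ i, D.u i (w.2.2 i) (z.1 i) =
      ∑ i, ∑ j, D.v i j * w.2.2 i j := by
    simp only [u, Finset.mul_sum]
    rw [Finset.sum_comm]
    refine Finset.sum_congr rfl fun i _ => ?_
    rw [Finset.sum_comm]
    refine Finset.sum_congr rfl fun j _ => ?_
    rw [← h.2.2.1 i j, Finset.sum_mul]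
    exact Finset.sum_congr rfl fun z _ => by ring
  have h0 : ∑ z ∈ cuts, p z * w.2.1 = w.2.1 := by rw [← Finset.sum_mul, h.2.1, one_mul]
  rw [relaxObj, h.c₁_dotProduct]
  simp only [slack, mul_sub, mul_add, Finset.sum_sub_distrib, Finset.sum_add_distrib]
  rw [hy, h0]
  ring

lemma dotProduct_le_of_nonpos {n : ℕ} {ξ x y : Fin n → ℝ} (hξ : ξ ≤ 0) (hxy : x ≤ y) :
    y ⬝ᵥ ξ ≤ ξ ⬝ᵥ x := by
  rw [dotProduct_comm]
  exact Finset.sum_le_sum fun k _ => mul_le_mul_of_nonpos_left (hxy k) (hξ k)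

lemma DualFeasible.dualObj_le {cuts : Finset D.Point} {ξin : Fin nin → ℝ} {ξeq : Fin neq → ℝ}
    {p : D.Point → ℝ} (h : D.DualFeasible cuts ξin ξeq p) {w : (Fin K₁ → ℝ) × ℝ × D.Coef}
    (hw : w ∈ D.relaxFeasible (cuts : Set D.Point)) :
    D.dualObj cuts ξin ξeq p ≤ D.relaxObj w := by
  obtain ⟨hs, hin, heq⟩ := mem_relaxFeasible.1 hw
  rw [h.relaxObj_eq w, dualObj, heq, dotProduct_comm D.qeq]
  have h1 := dotProduct_le_of_nonpos h.2.2.2.1 hin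
  have h2 : 0 ≤ ∑ z ∈ cuts, p z * D.slack z w :=
    Finset.sum_nonneg fun z hz => mul_nonneg (h.2.2.2.2 z hz) (hs z hz)
  linarith

/-- The linear part of the cut `z`. -/
noncomputable def cutLinear (D : Data N K₁ nin neq K₂) (z : D.Point) :
    ((Fin K₁ → ℝ) × ℝ × D.Coef) →ₗ[ℝ] ℝ where
  toFun w := w.2.1 + (∑ i, D.u i (w.2.2 i) (z.1 i)) - (D.Vᵀ *ᵥ z.2) ⬝ᵥ w.1
  map_add' w w' := by
    simp only [u, Prod.fst_add, Prod.snd_add, Pi.add_apply, add_mul, Finset.sum_add_distrib,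
      dotProduct_add]
    ring
  map_smul' r w := by
    simp only [u, Prod.smul_fst, Prod.smul_snd, Pi.smul_apply, smul_eq_mul, dotProduct_smul,
      RingHom.id_apply, mul_sub, mul_add, Finset.mul_sum, mul_assoc]

/-- The objective of the relaxation as a linear map. -/
noncomputable def relaxObjLinear (D : Data N K₁ nin neq K₂) : ((Fin K₁ → ℝ) × ℝ × D.Coef) →ₗ[ℝ] ℝ where
  toFun := D.relaxObj
  map_add' w w' := by
    simp only [relaxObj, Prod.fst_add, Prod.snd_add, Pi.add_apply, mul_add,
      Finset.sum_add_distrib, dotProduct_add]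
    ring
  map_smul' r w := by
    simp only [relaxObj, Prod.smul_fst, Prod.smul_snd, Pi.smul_apply, smul_eq_mul,
      dotProduct_smul, RingHom.id_apply, mul_add, Finset.mul_sum, mul_left_comm r]

/-- The value of a row of a matrix at the first-stage decision. -/
noncomputable def rowLinear (D : Data N K₁ nin neq K₂) {n : ℕ} (M : Matrix (Fin n) (Fin K₁) ℝ) (k : Fin n) :
    ((Fin K₁ → ℝ) × ℝ × D.Coef) →ₗ[ℝ] ℝ :=
  LinearMap.proj k ∘ₗ M.mulVecLin ∘ₗ LinearMap.fst ℝ _ _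

lemma exists_dualFeasible_eq {cuts : Finset D.Point} {w : (Fin K₁ → ℝ) × ℝ × D.Coef}
    (hw : D.IsRelaxOptimizer cuts w) :
    ∃ ξin ξeq p, D.DualFeasible cuts ξin ξeq p ∧ D.dualObj cuts ξin ξeq p = D.relaxObj w := by
  classical
  -- Each equation becomes two inequalities, so `ξeq` is a difference of multipliers. The rows of
  -- `Lin` are negated, which gives `ξin ≤ 0`.
  let f : cuts ⊕ Fin nin ⊕ Fin neq ⊕ Fin neq → ((Fin K₁ → ℝ) × ℝ × D.Coef) →ₗ[ℝ] ℝ :=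
    Sum.elim (fun z => D.cutLinear z) (Sum.elim (fun k => -D.rowLinear D.Lin k)
      (Sum.elim (fun k => D.rowLinear D.Leq k) (fun k => -D.rowLinear D.Leq k)))
  let b : cuts ⊕ Fin nin ⊕ Fin neq ⊕ Fin neq → ℝ :=
    Sum.elim (fun z => (D.W *ᵥ z.1.1 + D.b) ⬝ᵥ z.1.2) (Sum.elim (fun k => -D.qin k)
      (Sum.elim (fun k => D.qeq k) (fun k => -D.qeq k)))
  have hfeas : ∀ w, (∀ s, b s ≤ f s w) ↔ w ∈ D.relaxFeasible (cuts : Set D.Point) := by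
    intro w
    simp only [Sum.forall, f, b, Sum.elim_inl, Sum.elim_inr, LinearMap.neg_apply, neg_le_neg_iff,
      relaxFeasible, mem_ofPred_eq, Subtype.forall]
    refine and_congr Iff.rfl (and_congr Iff.rfl ?_)
    rw [← forall_and, funext_iff]
    exact forall_congr' fun k => ⟨fun h => le_antisymm h.2 h.1, fun h => ⟨h.ge, h.le⟩⟩
  obtain ⟨q, hq, hc, hval⟩ := exists_lp_multipliers f b D.relaxObjLinear w ((hfeas w).2 hw.1)
    fun w' hw' => hw.2 w' ((hfeas w').1 hw')
  let p : D.Point → ℝ := fun z => if h : z ∈ cuts then q (Sum.inl ⟨z, h⟩) else 0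
  have hp : ∀ F : D.Point → ℝ, ∑ z : cuts, q (Sum.inl z) * F z = ∑ z ∈ cuts, p z * F z := by
    intro F
    rw [← Finset.sum_coe_sort cuts]
    exact Finset.sum_congr rfl fun z _ => by simp [p]
  let ξin : Fin nin → ℝ := fun k => -q (Sum.inr (Sum.inl k))
  let ξeq : Fin neq → ℝ := fun k =>
    q (Sum.inr (Sum.inr (Sum.inl k))) - q (Sum.inr (Sum.inr (Sum.inr k)))
  have hobj : ∀ w', D.relaxObj w' = ∑ z ∈ cuts, p z * D.cutLinear z w' +
      ξin ⬝ᵥ (D.Lin *ᵥ w'.1) + ξeq ⬝ᵥ (D.Leq *ᵥ w'.1) := by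
    intro w'
    have := LinearMap.congr_fun hc w'
    rw [LinearMap.sum_apply] at this
    simp only [LinearMap.smul_apply, Fintype.sum_sum_type, f, Sum.elim_inl,
      Sum.elim_inr, smul_eq_mul, LinearMap.neg_apply, mul_neg, Finset.sum_neg_distrib,
      hp fun z => D.cutLinear z w'] at this
    refine Eq.trans this ?_
    simp only [dotProduct, ξin, ξeq, sub_mul, neg_mul, Finset.sum_neg_distrib,
      Finset.sum_sub_distrib]
    simp only [rowLinear, LinearMap.comp_apply, LinearMap.fst_apply, LinearMap.proj_apply,
      mulVecLin_apply]
    ring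
  refine ⟨ξin, ξeq, p, ⟨?_, ?_, fun i j => ?_, fun k => ?_, fun z hz => ?_⟩, ?_⟩
  -- The dual equations are `hobj` evaluated in the directions of `a`, of `y₀` and of the single
  -- coefficients of `y`.
  · refine dotProduct_eq _ _ fun a => ?_
    have := hobj (a, 0, 0)
    simp only [relaxObj, cutLinear, LinearMap.coe_mk, AddHom.coe_mk, u, Pi.zero_apply, zero_mul,
      Finset.sum_const_zero, add_zero, zero_sub, mul_neg, Finset.sum_neg_distrib,
      mul_zero] at this
    rw [this, sub_dotProduct, add_dotProduct, sum_dotProduct, dotProduct_mulVec_eq,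
      dotProduct_mulVec_eq]
    simp only [smul_dotProduct, smul_eq_mul]
    ring
  · have := hobj (0, 1, 0)
    simpa [relaxObj, cutLinear, u] using this.symm
  · have := hobj (0, 0, Pi.single i (Pi.single j 1))
    have hsum : ∀ F : (i : Fin N) → Fin (D.m i) → ℝ,
        ∑ i', ∑ j', F i' j' * (Pi.single i (Pi.single j 1) : D.Coef) i' j' = F i j := by
      intro F
      rw [Finset.sum_eq_single i (fun i' _ hi => by simp [hi]) (by simp),
        Finset.sum_eq_single j (fun j' _ hj => by simp [hj]) (by simp)]
      simp
    have hu : ∀ z : D.Point, ∑ i', D.u i' ((Pi.single i (Pi.single j 1) : D.Coef) i') (z.1 i') =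
        D.g i j (z.1 i) := by
      intro z
      rw [← hsum fun i' j' => D.g i' j' (z.1 i')]
      simp only [u, mul_comm]
    simp only [relaxObj, cutLinear, LinearMap.coe_mk, AddHom.coe_mk, hu, hsum, dotProduct_zero,
      zero_add, sub_zero, mulVec_zero, add_zero] at this
    exact this.symm
  · simpa [ξin] using hq _
  · simpa [p, hz] using hq _
  · change D.relaxObj w = _ at hval
    simp only [Fintype.sum_sum_type, b, Sum.elim_inl, Sum.elim_inr, mul_neg,
      Finset.sum_neg_distrib, hp fun z => (D.W *ᵥ z.1 + D.b) ⬝ᵥ z.2] at hval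
    rw [hval]
    rw [dualObj, dotProduct_comm D.qin, dotProduct_comm D.qeq]
    simp only [dotProduct, ξin, ξeq, sub_mul, neg_mul, Finset.sum_neg_distrib,
      Finset.sum_sub_distrib]
    ring

lemma IsRelaxOptimizer.exists_isDualOptimizer {cuts : Finset D.Point}
    {w : (Fin K₁ → ℝ) × ℝ × D.Coef} (hw : D.IsRelaxOptimizer cuts w) :
    ∃ ξin ξeq p, D.IsDualOptimizer cuts ξin ξeq p := by
  obtain ⟨ξin, ξeq, p, h, heq⟩ := exists_dualFeasible_eq hw
  exact ⟨ξin, ξeq, p, h, fun _ _ _ h' => (h'.dualObj_le hw.1).trans_eq heq.symm⟩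

lemma IsRelaxOptimizer.relaxObj_le_dualObj {cuts : Finset D.Point}
    {w : (Fin K₁ → ℝ) × ℝ × D.Coef} (hw : D.IsRelaxOptimizer cuts w) {ξin : Fin nin → ℝ}
    {ξeq : Fin neq → ℝ} {p : D.Point → ℝ} (h : D.IsDualOptimizer cuts ξin ξeq p) :
    D.relaxObj w ≤ D.dualObj cuts ξin ξeq p := by
  obtain ⟨ξin', ξeq', p', h', heq⟩ := exists_dualFeasible_eq hw
  exact heq.symm.trans_le (h.2 _ _ _ h')

/-! ### The cutting-plane algorithm -/

lemma continuous_globalObj (a : Fin K₁ → ℝ) (y₀ : ℝ) (y : D.Coef) :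
    Continuous (D.globalObj a y₀ y) := by
  have h : ∀ i, Continuous fun lam : Fin K₂ → ℝ => D.conj i (y i) ((D.Wᵀ *ᵥ lam) i) := fun i =>
    (continuous_conj i (y i)).comp (by fun_prop)
  unfold globalObj
  fun_prop

lemma Assumptions.exists_isValid (hD : D.Assumptions) {cuts : Finset D.Point}
    (hcuts : ∀ z ∈ cuts, z.1 ∈ D.XX ∧ z.2 ∈ D.S₂)
    (hbdd : D.BoundedSublevel (cuts : Set D.Point)) : ∃ I : Iterate D, I.IsValid cuts := by
  obtain ⟨w₀, hw₀⟩ := hD.exists_feasible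
  obtain ⟨⟨a, y₀, y⟩, hw⟩ := exists_isRelaxOptimizer hbdd
    ⟨w₀, relaxFeasible_antitone (fun z hz => hcuts z hz) hw₀⟩
  obtain ⟨ξin, ξeq, p, hdual⟩ := hw.exists_isDualOptimizer
  obtain ⟨lam, hlam, hmin⟩ := hD.isCompact_S₂.exists_isMinOn hD.S₂_nonempty
    (continuous_globalObj a y₀ y).continuousOn
  choose y' hy' hy'' using fun i => hD.exists_biconj_coef i (y i)
  exact ⟨⟨a, y₀, y, ξin, ξeq, p, lam, {lam}, y'⟩, hw, hdual, hlam, fun l hl => hmin hl,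
    by simpa using hlam, by simp, hy', hy''⟩

lemma Iterate.exists_isUpdate (I : Iterate D) (cuts : Finset D.Point) :
    ∃ cuts', I.IsUpdate cuts cuts' := by
  choose k hk using fun (lam : Fin K₂ → ℝ) (i : Fin N) => Finite.exists_max fun k =>
    (D.Wᵀ *ᵥ lam) i * D.knot i k - D.u i (I.y i) (D.knot i k)
  refine ⟨_, fun lam i => D.knot i (k lam i), fun lam _ i => ⟨⟨_, rfl⟩, ?_⟩, rfl⟩
  rintro _ ⟨l, rfl⟩
  exact hk lam i l

lemma Iterate.IsUpdate.subset {I : Iterate D} {cuts cuts' : Finset D.Point}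
    (h : I.IsUpdate cuts cuts') : cuts ⊆ cuts' := by
  obtain ⟨x, -, rfl⟩ := h
  exact Finset.subset_union_left

lemma Assumptions.isUpdate_mem (hD : D.Assumptions) {I : Iterate D} {cuts cuts' : Finset D.Point}
    (hI : I.IsValid cuts) (h : I.IsUpdate cuts cuts')
    (hcuts : ∀ z ∈ cuts, z.1 ∈ D.XX ∧ z.2 ∈ D.S₂) : ∀ z ∈ cuts', z.1 ∈ D.XX ∧ z.2 ∈ D.S₂ := by
  obtain ⟨x, hx, rfl⟩ := h
  intro z hz
  rcases Finset.mem_union.1 hz with hz | hz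
  · exact hcuts z hz
  · obtain ⟨lam, hlam, rfl⟩ := Finset.mem_image.1 hz
    refine ⟨fun i => ?_, hI.dirs_subset hlam⟩
    obtain ⟨k, hk⟩ := (hx lam hlam i).1
    change x lam i ∈ D.X i
    rw [← hk]
    exact hD.knot_mem i k

lemma Assumptions.reachable (hD : D.Assumptions) {ε : ℝ} {cuts₀ cuts : Finset D.Point}
    (hcuts₀ : ∀ z ∈ cuts₀, z.1 ∈ D.XX ∧ z.2 ∈ D.S₂) (h : D.Reachable ε cuts₀ cuts) :
    cuts₀ ⊆ cuts ∧ ∀ z ∈ cuts, z.1 ∈ D.XX ∧ z.2 ∈ D.S₂ := by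
  induction h with
  | start => exact ⟨Finset.Subset.refl _, hcuts₀⟩
  | step _ hs ih => exact ⟨ih.1.trans hs.2.2.subset, hD.isUpdate_mem hs.1 hs.2.2 ih.2⟩

lemma BoundedSublevel.mono {cuts cuts' : Set D.Point} (h : D.BoundedSublevel cuts)
    (hsub : cuts ⊆ cuts') : D.BoundedSublevel cuts' := fun t =>
  (h t).subset fun _ hw => ⟨relaxFeasible_antitone hsub hw.1, hw.2⟩

lemma Assumptions.exists_cut_slack_eq (hD : D.Assumptions) {I : Iterate D}
    {cuts cuts' : Finset D.Point} (hI : I.IsValid cuts) (h : I.IsUpdate cuts cuts') :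
    ∃ z ∈ cuts', D.slack z (I.a, I.y₀, I.y) = I.s := by
  obtain ⟨x, hx, rfl⟩ := h
  refine ⟨(x I.lamStar, I.lamStar), Finset.mem_union_right _
    (Finset.mem_image_of_mem _ hI.lamStar_mem_dirs), ?_⟩
  have hconj : ∀ i, D.conj i (I.y i) ((D.Wᵀ *ᵥ I.lamStar) i) = (D.Wᵀ *ᵥ I.lamStar) i *
      x I.lamStar i - D.u i (I.y i) (x I.lamStar i) := fun i =>
    hD.conj_eq_of_isMax i _ _ (hx _ hI.lamStar_mem_dirs i).1 (hx _ hI.lamStar_mem_dirs i).2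
  have e1 : ∑ i, (D.Wᵀ *ᵥ I.lamStar) i * x I.lamStar i = (D.W *ᵥ x I.lamStar) ⬝ᵥ I.lamStar := by
    rw [dotProduct_comm, dotProduct_mulVec_eq]
    rfl
  rw [Iterate.s, globalObj, slack]
  simp only [hconj, Finset.sum_sub_distrib, e1, add_dotProduct]
  rw [dotProduct_comm (D.V *ᵥ I.a), dotProduct_mulVec_eq]
  ring

/-- Since the moments are nonnegative and `yDiam ≤ y`, passing to the biconjugate can only lower the
objective; the correction of the intercept contributes `-s`. -/
lemma Assumptions.upper_sub_lower_le (hD : D.Assumptions) {I : Iterate D}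
    {cuts : Finset D.Point} (hI : I.IsValid cuts) : I.upper - I.lower ≤ -I.s := by
  have : ∑ i, ∑ j, D.v i j * I.yDiam i j ≤ ∑ i, ∑ j, D.v i j * I.y i j :=
    Finset.sum_le_sum fun i _ => Finset.sum_le_sum fun j _ =>
      mul_le_mul_of_nonneg_left (hI.yDiam_le i j) (hD.v_nonneg i j)
  simp only [Iterate.upper, Iterate.lower, Iterate.y₀Diam, relaxObj]
  linarith

lemma Assumptions.not_exists_infinite_run (hD : D.Assumptions) {ε : ℝ} (hε : 0 < ε)
    {cuts₀ : Finset D.Point} (hcuts₀ : ∀ z ∈ cuts₀, z.1 ∈ D.XX ∧ z.2 ∈ D.S₂)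
    (hbdd : D.BoundedSublevel (cuts₀ : Set D.Point)) (cuts : ℕ → Finset D.Point)
    (I : ℕ → Iterate D) (h0 : cuts 0 = cuts₀)
    (hstep : ∀ r, D.IsStep ε (cuts r) (I r) (cuts (r + 1))) : False := by
  have hmono : Monotone cuts := monotone_nat_of_le_succ fun r => (hstep r).2.2.subset
  have hmem : ∀ r, ∀ z ∈ cuts r, z.1 ∈ D.XX ∧ z.2 ∈ D.S₂ := by
    intro r
    induction r with
    | zero => rwa [h0]
    | succ r ih => exact hD.isUpdate_mem (hstep r).1 (hstep r).2.2 ih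
  obtain ⟨w₀, hw₀⟩ := hD.exists_feasible
  let w : ℕ → (Fin K₁ → ℝ) × ℝ × D.Coef := fun r => ((I r).a, (I r).y₀, (I r).y)
  have hw : ∀ r, D.IsRelaxOptimizer (cuts r) (w r) := fun r => (hstep r).1.primal
  choose z hz hzs using fun r => hD.exists_cut_slack_eq (hstep r).1 (hstep r).2.2
  -- The variable `w₀` satisfies all cuts, so every optimizer lies in one sublevel set of the
  -- initial relaxation.
  have hK := ((isCompact_XX (D := D)).prod hD.isCompact_S₂).prod (Metric.isCompact_of_isClosed_isBounded
    ((isClosed_relaxFeasible (cuts₀ : Set D.Point)).inter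
      (isClosed_le continuous_relaxObj continuous_const)) (hbdd (D.relaxObj w₀)))
  obtain ⟨q, -, θ, hθ, hlim⟩ := hK.tendsto_subseq (x := fun r => (z r, w r)) fun r =>
    ⟨hmem _ _ (hz r), relaxFeasible_antitone
      (Finset.coe_subset.2 (h0 ▸ hmono (Nat.zero_le r))) (hw r).1,
      (hw r).2 _ (relaxFeasible_antitone (fun z hz => hmem r z hz) hw₀)⟩
  have hz_lim : Filter.Tendsto (fun n => z (θ n)) Filter.atTop (nhds q.1) :=
    (continuous_fst.tendsto q).comp hlim
  -- The shift pairs each cut with a later optimizer, which satisfies it. Unshifted, the slack is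
  -- `s`, below `-ε`; both pairings have the same limit.
  have hw_lim : Filter.Tendsto (fun n => w (θ (n + 1))) Filter.atTop (nhds q.2) :=
    ((continuous_snd.tendsto q).comp hlim).comp (Filter.tendsto_add_atTop_nat 1)
  have hs : Filter.Tendsto (fun n => (I (θ n)).s) Filter.atTop (nhds (D.slack q.1 q.2)) := by
    refine ((continuous_slack.tendsto q).comp hlim).congr fun n => ?_
    exact hzs (θ n)
  have hnn : 0 ≤ D.slack q.1 q.2 := by
    refine ge_of_tendsto' ((continuous_slack.tendsto q).comp (hz_lim.prodMk_nhds hw_lim))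
      fun n => ?_
    exact (mem_relaxFeasible.1 (hw (θ (n + 1))).1).1 _
      (hmono (Nat.succ_le_of_lt (hθ (Nat.lt_succ_self n))) (hz (θ n)))
  have hle : D.slack q.1 q.2 ≤ -ε := le_of_tendsto' hs fun n => by
    have h1 := (hstep (θ n)).2.1
    have h2 := hD.upper_sub_lower_le (hstep (θ n)).1
    linarith
  linarith

lemma Assumptions.alwaysTerminates (hD : D.Assumptions) {ε : ℝ} (hε : 0 < ε)
    {cuts₀ : Finset D.Point} (hcuts₀ : ∀ z ∈ cuts₀, z.1 ∈ D.XX ∧ z.2 ∈ D.S₂)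
    (hbdd : D.BoundedSublevel (cuts₀ : Set D.Point)) : D.AlwaysTerminates ε cuts₀ := by
  refine ⟨fun cuts h => ?_, ?_⟩
  · obtain ⟨h1, h2⟩ := hD.reachable hcuts₀ h
    exact ⟨hD.exists_isValid h2 (hbdd.mono (Finset.coe_subset.2 h1)),
      fun I _ => I.exists_isUpdate cuts⟩
  · rintro ⟨cuts, I, h0, hstep⟩
    exact hD.not_exists_infinite_run hε hcuts₀ hbdd cuts I h0 hstep

/-- If no reachable state could stop, every one would have a successor, and iterating a choice of
successors would give an infinite run. -/
lemma AlwaysTerminates.exists_stopsWith {ε : ℝ} {cuts₀ : Finset D.Point}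
    (h : D.AlwaysTerminates ε cuts₀) : ∃ cuts I, D.StopsWith ε cuts₀ cuts I := by
  by_contra! hno
  have hnext : ∀ c : {c // D.Reachable ε cuts₀ c}, ∃ I : Iterate D, ∃ c' :
      {c // D.Reachable ε cuts₀ c}, D.IsStep ε c I c' := by
    rintro ⟨c, hc⟩
    obtain ⟨⟨I, hI⟩, hup⟩ := h.1 c hc
    obtain ⟨c', hc'⟩ := hup I hI
    have hs : D.IsStep ε c I c' := ⟨hI, not_le.1 fun hle => hno c I ⟨hc, hI, hle⟩, hc'⟩
    exact ⟨I, ⟨c', hc.step hs⟩, hs⟩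
  choose J next hJ using hnext
  let c : ℕ → {c // D.Reachable ε cuts₀ c} := fun r => next^[r] ⟨cuts₀, Reachable.start⟩
  refine h.2 ⟨fun r => c r, fun r => J (c r), rfl, fun r => ?_⟩
  have : c (r + 1) = next (c r) := Function.iterate_succ_apply' _ _ _
  change D.IsStep ε (c r) (J (c r)) (c (r + 1))
  rw [this]
  exact hJ (c r)

end Data

end TwoStageDRO

namespace TwoStageDRO

open Set

namespace Data

variable {N K₁ nin neq K₂ : ℕ} {D : Data N K₁ nin neq K₂}

/-! ### The upper bound -/

lemma dotProduct_eq_sum_transpose (x : Fin N → ℝ) (lam : Fin K₂ → ℝ) :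
    (D.W *ᵥ x) ⬝ᵥ lam = ∑ i, (D.Wᵀ *ᵥ lam) i * x i := by
  rw [dotProduct_comm, dotProduct_mulVec_eq]
  rfl

lemma continuous_cost (a : Fin K₁ → ℝ) : Continuous fun z : D.Point =>
    (D.V *ᵥ a + D.W *ᵥ z.1 + D.b) ⬝ᵥ z.2 := by
  fun_prop

lemma Assumptions.continuous_Q (hD : D.Assumptions) (a : Fin K₁ → ℝ) : Continuous (D.Q a) :=
  hD.isCompact_S₂.continuous_sSup
    (f := fun x lam => (D.V *ᵥ a + D.W *ᵥ x + D.b) ⬝ᵥ lam) (continuous_cost a)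

lemma Assumptions.le_Q (hD : D.Assumptions) (a : Fin K₁ → ℝ) (x : Fin N → ℝ)
    {lam : Fin K₂ → ℝ} (hlam : lam ∈ D.S₂) :
    (D.V *ᵥ a + D.W *ᵥ x + D.b) ⬝ᵥ lam ≤ D.Q a x :=
  le_csSup (hD.isCompact_S₂.bddAbove_image
    ((continuous_cost (D := D) a).comp (Continuous.prodMk_right x)).continuousOn) ⟨lam, hlam, rfl⟩

lemma Assumptions.Q_le (hD : D.Assumptions) {I : Iterate D} {cuts : Finset D.Point}
    (hI : I.IsValid cuts) {x : Fin N → ℝ} (hx : x ∈ D.XX) :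
    D.Q I.a x ≤ I.y₀Diam + ∑ i, D.u i (I.yDiam i) (x i) := by
  refine csSup_le (hD.S₂_nonempty.image _) ?_
  rintro _ ⟨lam, hlam, rfl⟩
  have h1 := hI.lamStar_opt lam hlam
  have h2 : ∑ i, ((D.Wᵀ *ᵥ lam) i * x i - D.conj i (I.y i) ((D.Wᵀ *ᵥ lam) i)) ≤
      ∑ i, D.u i (I.yDiam i) (x i) := Finset.sum_le_sum fun i _ => by
    rw [hI.yDiam_eq i _ (hx i)]
    exact hD.affine_sub_conj_le_biconj i _ _ (hx i)
  rw [Finset.sum_sub_distrib, ← dotProduct_eq_sum_transpose] at h2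
  simp only [Iterate.y₀Diam, globalObj, add_dotProduct] at h1 ⊢
  linarith

lemma Assumptions.ae_mem_XX (hD : D.Assumptions) {π : Measure (Fin N → ℝ)}
    (hπ : π ∈ D.couplings) : ∀ᵐ x ∂π, x ∈ D.XX := by
  have : ∀ i, ∀ᵐ x ∂π, x i ∈ D.X i := fun i => by
    have h : ∀ᵐ t ∂(π.map fun x => x i), t ∈ D.X i := by
      rw [hπ.2 i]
      exact (hD.prob i).2
    exact ae_of_ae_map (measurable_pi_apply i).aemeasurable h
  exact ae_all_iff.2 this

lemma Assumptions.integrable_of_mem_couplings (hD : D.Assumptions) {π : Measure (Fin N → ℝ)}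
    (hπ : π ∈ D.couplings) {f : (Fin N → ℝ) → ℝ} (hf : Continuous f) : Integrable f π := by
  have := hπ.1
  obtain ⟨M, hM⟩ := (isCompact_XX (D := D)).exists_bound_of_continuousOn hf.continuousOn
  exact .of_bound hf.aestronglyMeasurable M ((hD.ae_mem_XX hπ).mono hM)

lemma continuous_u_eval (i : Fin N) (y : Fin (D.m i) → ℝ) :
    Continuous fun x : Fin N → ℝ => D.u i y (x i) :=
  (continuous_u i y).comp (continuous_apply i)

lemma Assumptions.integral_u (hD : D.Assumptions) {π : Measure (Fin N → ℝ)}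
    (hπ : π ∈ D.couplings) (i : Fin N) (y : Fin (D.m i) → ℝ) :
    ∫ x, D.u i y (x i) ∂π = ∑ j, D.v i j * y j := by
  have hint : ∀ j ∈ Finset.univ, Integrable (fun x : Fin N → ℝ => y j * D.g i j (x i)) π :=
    fun j _ => hD.integrable_of_mem_couplings hπ
      (continuous_const.mul ((continuous_g i j).comp (continuous_apply i)))
  simp only [u]
  rw [integral_finsetSum _ hint]
  refine Finset.sum_congr rfl fun j _ => ?_
  rw [integral_const_mul, mul_comm, v, ← hπ.2 i, integral_map
    (measurable_pi_apply i).aemeasurable (continuous_g i j).aestronglyMeasurable]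

lemma Assumptions.φ_le_upper (hD : D.Assumptions) {I : Iterate D} {cuts : Finset D.Point}
    (hI : I.IsValid cuts) : D.φ I.a ≤ (I.upper : EReal) := by
  have h : ⨆ π ∈ D.couplings, ((∫ x, D.Q I.a x ∂π : ℝ) : EReal) ≤
      ((I.y₀Diam + ∑ i, ∑ j, D.v i j * I.yDiam i j : ℝ) : EReal) := by
    refine iSup₂_le fun π hπ => EReal.coe_le_coe_iff.2 ?_
    have := hπ.1
    have hint : ∀ i ∈ Finset.univ, Integrable (fun x : Fin N → ℝ => D.u i (I.yDiam i) (x i)) π :=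
      fun i _ => hD.integrable_of_mem_couplings hπ (continuous_u_eval i _)
    calc ∫ x, D.Q I.a x ∂π ≤ ∫ x, (I.y₀Diam + ∑ i, D.u i (I.yDiam i) (x i)) ∂π := by
          refine integral_mono_ae (hD.integrable_of_mem_couplings hπ (hD.continuous_Q _))
            ((integrable_const _).add (integrable_finsetSum _ hint))
            ((hD.ae_mem_XX hπ).mono fun x hx => hD.Q_le hI hx)
      _ = _ := by
          rw [integral_add (integrable_const _) (integrable_finsetSum _ hint), integral_const,
            integral_finsetSum _ hint]
          simp [hD.integral_u hπ]
  refine (add_le_add_right h _).trans_eq ?_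
  rw [← EReal.coe_add, Iterate.upper, relaxObj, add_assoc]

/-! ### Partial reassembly -/

lemma sum_atoms {J : ℕ} {cuts : Finset D.Point} {p : D.Point → ℝ} {pts : Fin J → D.Point}
    (hinj : Function.Injective pts) (hp : ∀ z ∈ cuts, 0 ≤ p z)
    (hpts : ∀ z, z ∈ range pts ↔ z ∈ cuts ∧ 0 < p z) (F : D.Point → ℝ) :
    ∑ j, p (pts j) * F (pts j) = ∑ z ∈ cuts, p z * F z := by
  classical
  rw [← Finset.sum_image (f := fun z => p z * F z) (s := Finset.univ) (g := pts)
    fun _ _ _ _ h => hinj h]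
  refine Finset.sum_subset (fun z hz => ?_) fun z hz hz' => ?_
  · obtain ⟨j, -, rfl⟩ := Finset.mem_image.1 hz
    exact ((hpts _).1 ⟨j, rfl⟩).1
  · have : ¬ 0 < p z := fun h => hz' (by
      obtain ⟨j, hj⟩ := (hpts z).2 ⟨hz, h⟩
      exact Finset.mem_image.2 ⟨j, Finset.mem_univ _, hj⟩)
    rw [le_antisymm (not_lt.1 this) (hp z hz), zero_mul]

/-- What the reassembly provides: a joint distribution of the discrete measure and of a coupling of
the marginals whose coordinates are comonotone. -/
structure IsComonotonePair (D : Data N K₁ nin neq K₂) {Ω : Type*} [MeasurableSpace Ω]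
    (P : Measure Ω) (cuts : Finset D.Point) (p : D.Point → ℝ) (A Xt : Ω → Fin N → ℝ)
    (Lam : Ω → Fin K₂ → ℝ) : Prop where
  prob : IsProbabilityMeasure P
  measurable_atom : Measurable A
  measurable_Xt : Measurable Xt
  measurable_Lam : Measurable Lam
  atom_mem : ∀ ω, A ω ∈ D.XX
  Xt_mem : ∀ ω, Xt ω ∈ D.XX
  Lam_mem : ∀ ω, Lam ω ∈ D.S₂
  integral_atom : ∀ F : D.Point → ℝ, ∫ ω, F (A ω, Lam ω) ∂P = ∑ z ∈ cuts, p z * F z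
  map_Xt : ∀ i, P.map (fun ω => Xt ω i) = D.μ i
  nested : ∀ i t, {ω | A ω i ≤ t} ⊆ {ω | Xt ω i ≤ t} ∨ {ω | Xt ω i ≤ t} ⊆ {ω | A ω i ≤ t}

lemma IsReassembly.exists_isComonotonePair (hD : D.Assumptions) {Ω : Type*} [MeasurableSpace Ω]
    {P : Measure Ω} {cuts : Finset D.Point} (hcuts : ∀ z ∈ cuts, z.1 ∈ D.XX ∧ z.2 ∈ D.S₂)
    {p : D.Point → ℝ} (hp : ∀ z ∈ cuts, 0 ≤ p z) (hp1 : ∑ z ∈ cuts, p z = 1)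
    {Xt : Ω → Fin N → ℝ} {Lam : Ω → Fin K₂ → ℝ} (h : D.IsReassembly P cuts p Xt Lam) :
    ∃ A, D.IsComonotonePair P cuts p A Xt Lam := by
  obtain ⟨hP, J, pts, σ, Z, C, hinj, hpts, hσ, hZ, hZp, hC, hC01, hunif, hind, hLam, hXt⟩ := h
  have hα : ∀ j, 0 < p (pts j) := fun j => ((hpts _).1 ⟨j, rfl⟩).2
  have hα' : ∀ j, 0 ≤ p (pts j) := fun j => (hα j).le
  have hα1 : ∑ j, p (pts j) = 1 := by
    have := sum_atoms hinj hp hpts fun _ => 1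
    simpa [hp1] using this
  have hmem : ∀ j, (pts j).1 ∈ D.XX ∧ (pts j).2 ∈ D.S₂ := fun j =>
    hcuts _ ((hpts _).1 ⟨j, rfl⟩).1
  have hCi : ∀ i, Measurable fun ω => C ω i := fun i => (measurable_pi_apply i).comp hC
  have hCi01 : ∀ i ω, C ω i ∈ Icc (0 : ℝ) 1 := fun i ω => hC01 ω i
  have hindi : ∀ i, IndepFun (fun ω => C ω i) Z P := fun i =>
    hind.comp (measurable_pi_apply i) measurable_id
  let U : Fin N → Ω → ℝ := fun i => rankTransform (fun j => p (pts j)) (σ i) Z fun ω => C ω i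
  have hU : ∀ i, Measurable (U i) := fun i => measurable_rankTransform hZ (hCi i)
  have hU01 : ∀ i ω, U i ω ∈ Icc (0 : ℝ) 1 := fun i ω =>
    rankTransform_mem_Icc hα' hα1 (hCi01 i) ω
  have hXU : ∀ i, (fun ω => Xt ω i) = fun ω => quantile (D.X i) (D.μ i) (U i ω) := fun i => by
    ext ω
    rw [hXt ω i]
    rfl
  have hXU' : ∀ i ω, Xt ω i = quantile (D.X i) (D.μ i) (U i ω) := fun i ω => congrFun (hXU i) ω
  -- Atoms separated by the level `t` in coordinate `i` have strictly ordered ranks, hence ordered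
  -- transforms and ordered quantiles. Ties are never compared.
  have hA : ∀ i t, ∀ ω ω', (pts (Z ω)).1 i ≤ t → t < (pts (Z ω')).1 i → Xt ω i ≤ Xt ω' i := by
    intro i t ω ω' h h'
    rw [hXU', hXU']
    refine quantile_mono (isCompact_X i) (hD.prob i) ?_ (hU01 i ω').2
    refine rankTransform_le_of_rank_lt hα' (hCi01 i) (not_le.1 fun hle => ?_)
    have := hσ i hle
    simp only [Equiv.symm_apply_apply] at this
    linarith
  refine ⟨fun ω => (pts (Z ω)).1, hP, (measurable_of_finite fun j => (pts j).1).comp hZ,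
    measurable_pi_lambda _ fun i => ?_, ?_, fun ω => (hmem _).1, fun ω i => ?_, fun ω => ?_,
    fun F => ?_, fun i => ?_, fun i t => ?_⟩
  · rw [hXU]
    exact measurable_quantile_comp (isCompact_X i) (hD.prob i) (hU i) (hU01 i)
  · rw [show Lam = (fun j => (pts j).2) ∘ Z from funext hLam]
    exact (measurable_of_finite fun j => (pts j).2).comp hZ
  · rw [hXU']
    exact quantile_mem (isCompact_X i) (hD.prob i) (hU01 i ω).2
  · rw [hLam]
    exact (hmem _).2
  · simp only [hLam]
    have hm : Measurable fun j => F (pts j) := measurable_of_finite _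
    have := Measure.isProbabilityMeasure_map (μ := P) hZ.aemeasurable
    rw [← sum_atoms hinj hp hpts F,
      ← integral_map (f := fun j => F (pts j)) hZ.aemeasurable hm.aestronglyMeasurable,
      integral_fintype .of_finite]
    refine Finset.sum_congr rfl fun j _ => ?_
    rw [map_measureReal_apply hZ (measurableSet_singleton j), smul_eq_mul, ← hZp j]
    rfl
  · rw [hXU]
    exact map_quantile_comp (isCompact_X i) (hD.prob i) (hU i) (hU01 i) fun t ht =>
      measureReal_rankTransform_le hα hα1 hZ hZp (hCi i) (hunif i) (hindi i) ht
  · by_contra! hcon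
    obtain ⟨⟨ω, h1, h2⟩, ω', h3, h4⟩ := hcon.imp Set.not_subset.1 Set.not_subset.1
    simp only [mem_ofPred_eq, not_le] at h1 h2 h3 h4
    exact absurd (hA i t ω ω' h1 h4) (not_le.2 (h3.trans_lt h2))

/-! ### The lower bound and the cost of the reassembly -/

section ComonotonePair

variable {Ω : Type*} [MeasurableSpace Ω] {P : Measure Ω} {cuts : Finset D.Point}
  {p : D.Point → ℝ} {A Xt : Ω → Fin N → ℝ} {Lam : Ω → Fin K₂ → ℝ}

lemma Assumptions.integrable_comp (hD : D.Assumptions) [IsFiniteMeasure P]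
    {Y : Ω → Fin N → ℝ} (hY : Measurable Y) (hYX : ∀ ω, Y ω ∈ D.XX) (hLam : Measurable Lam)
    (hLamS : ∀ ω, Lam ω ∈ D.S₂) {F : D.Point → ℝ} (hF : Continuous F) :
    Integrable (fun ω => F (Y ω, Lam ω)) P := by
  obtain ⟨M, hM⟩ := ((isCompact_XX (D := D)).prod hD.isCompact_S₂).exists_bound_of_continuousOn
    hF.continuousOn
  exact .of_bound (hF.measurable.comp (hY.prodMk hLam)).aestronglyMeasurable M
    (ae_of_all _ fun ω => hM _ ⟨hYX ω, hLamS ω⟩)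

lemma IsComonotonePair.map_mem_couplings (h : D.IsComonotonePair P cuts p A Xt Lam) :
    P.map Xt ∈ D.couplings := by
  have := h.prob
  refine ⟨Measure.isProbabilityMeasure_map h.measurable_Xt.aemeasurable, fun i => ?_⟩
  rw [Measure.map_map (measurable_pi_apply i) h.measurable_Xt]
  exact h.map_Xt i

lemma continuous_recourse : Continuous fun z : D.Point => (D.W *ᵥ z.1 + D.b) ⬝ᵥ z.2 := by
  fun_prop

lemma Assumptions.lower_le_φDRO (hD : D.Assumptions) (h : D.IsComonotonePair P cuts p A Xt Lam)
    {ξin : Fin nin → ℝ} {ξeq : Fin neq → ℝ} (hdual : D.DualFeasible cuts ξin ξeq p) :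
    ((D.qin ⬝ᵥ ξin + D.qeq ⬝ᵥ ξeq + ∫ ω, (D.W *ᵥ Xt ω + D.b) ⬝ᵥ Lam ω ∂P : ℝ) : EReal) ≤
      D.φDRO := by
  have := h.prob
  refine le_iInf₂ fun a ha => ?_
  refine le_trans ?_ (add_le_add_right (le_iSup₂ (f := fun π (_ : π ∈ D.couplings) =>
    ((∫ x, D.Q a x ∂π : ℝ) : EReal)) _ h.map_mem_couplings) _)
  rw [← EReal.coe_add, EReal.coe_le_coe_iff]
  have hQ : ∫ x, D.Q a x ∂(P.map Xt) = ∫ ω, D.Q a (Xt ω) ∂P :=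
    integral_map h.measurable_Xt.aemeasurable (hD.continuous_Q a).aestronglyMeasurable
  have hV : ∫ ω, (D.Vᵀ *ᵥ Lam ω) ⬝ᵥ a ∂P = ∑ z ∈ cuts, p z * ((D.Vᵀ *ᵥ z.2) ⬝ᵥ a) :=
    h.integral_atom fun z => (D.Vᵀ *ᵥ z.2) ⬝ᵥ a
  have hi1 : Integrable (fun ω => (D.Vᵀ *ᵥ Lam ω) ⬝ᵥ a) P :=
    hD.integrable_comp h.measurable_Xt h.Xt_mem h.measurable_Lam h.Lam_mem
      (F := fun z => (D.Vᵀ *ᵥ z.2) ⬝ᵥ a) (by fun_prop)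
  have hi2 : Integrable (fun ω => (D.W *ᵥ Xt ω + D.b) ⬝ᵥ Lam ω) P :=
    hD.integrable_comp h.measurable_Xt h.Xt_mem h.measurable_Lam h.Lam_mem continuous_recourse
  have hi3 : Integrable (fun ω => D.Q a (Xt ω)) P :=
    hD.integrable_comp h.measurable_Xt h.Xt_mem h.measurable_Lam h.Lam_mem
      (F := fun z => D.Q a z.1) ((hD.continuous_Q a).comp continuous_fst)
  -- `Lam ω` is merely a feasible second-stage choice at `Xt ω`, so its cost is at most `Q`.
  have hle : ∫ ω, (D.Vᵀ *ᵥ Lam ω) ⬝ᵥ a ∂P + ∫ ω, (D.W *ᵥ Xt ω + D.b) ⬝ᵥ Lam ω ∂P ≤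
      ∫ ω, D.Q a (Xt ω) ∂P := by
    rw [← integral_add hi1 hi2]
    refine integral_mono (hi1.add hi2) hi3 fun ω => ?_
    refine le_trans (le_of_eq ?_) (hD.le_Q a (Xt ω) (h.Lam_mem ω))
    simp only [add_dotProduct]
    rw [← dotProduct_mulVec_eq, dotProduct_comm (Lam ω)]
    ring
  have hin := dotProduct_le_of_nonpos hdual.2.2.2.1 ha.1
  rw [hQ, hdual.c₁_dotProduct, ha.2, ← hV, dotProduct_comm D.qeq]
  linarith

lemma IsComonotonePair.map_atom_mem_momentSet (hD : D.Assumptions)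
    (h : D.IsComonotonePair P cuts p A Xt Lam)
    (hv : ∀ i j, ∑ z ∈ cuts, p z * D.g i j (z.1 i) = D.v i j) (i : Fin N) :
    P.map (fun ω => A ω i) ∈ momentSet (D.X i) (cpwaSet (D.knot i)) (D.μ i) := by
  have := h.prob
  have hm : Measurable fun ω => A ω i := (measurable_pi_apply i).comp h.measurable_atom
  refine ⟨⟨Measure.isProbabilityMeasure_map hm.aemeasurable, ?_⟩, ?_⟩
  · rw [Measure.map_apply hm (isCompact_X i).measurableSet.compl, preimage_compl,
      show (fun ω => A ω i) ⁻¹' D.X i = univ from eq_univ_of_forall fun ω => h.atom_mem ω i,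
      compl_univ, measure_empty]
  · rintro _ ⟨j, rfl⟩
    have hc : Continuous (D.g i j) := continuous_g i j
    change Integrable (D.g i j) _ ∧ ∫ x, D.g i j x ∂_ = ∫ x, D.g i j x ∂_
    constructor
    · rw [integrable_map_measure hc.aestronglyMeasurable hm.aemeasurable]
      exact hD.integrable_comp h.measurable_atom h.atom_mem h.measurable_Lam h.Lam_mem
        (F := fun z => D.g i j (z.1 i)) (hc.comp (by fun_prop))
    · rw [integral_map hm.aemeasurable hc.aestronglyMeasurable]
      exact (h.integral_atom fun z => D.g i j (z.1 i)).trans (hv i j)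

lemma Assumptions.dualObj_sub_le (hD : D.Assumptions) (h : D.IsComonotonePair P cuts p A Xt Lam)
    (hv : ∀ i j, ∑ z ∈ cuts, p z * D.g i j (z.1 i) = D.v i j) :
    ∑ z ∈ cuts, p z * ((D.W *ᵥ z.1 + D.b) ⬝ᵥ z.2) - ∫ ω, (D.W *ᵥ Xt ω + D.b) ⬝ᵥ Lam ω ∂P ≤
      (∑ i, (W1bar (D.X i) (cpwaSet (D.knot i)) (D.μ i)).toReal) *
        sSup ((fun lam => ‖D.Wᵀ *ᵥ lam‖) '' D.S₂) := by
  have := h.prob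
  set M := sSup ((fun lam => ‖D.Wᵀ *ᵥ lam‖) '' D.S₂) with hM
  have hMle : ∀ lam ∈ D.S₂, ‖D.Wᵀ *ᵥ lam‖ ≤ M := fun lam hlam =>
    le_csSup (hD.isCompact_S₂.bddAbove_image (by fun_prop)) ⟨lam, hlam, rfl⟩
  have hM0 : 0 ≤ M := by
    obtain ⟨lam, hlam⟩ := hD.S₂_nonempty
    exact (norm_nonneg _).trans (hMle lam hlam)
  have hi1 : Integrable (fun ω => (D.W *ᵥ A ω + D.b) ⬝ᵥ Lam ω) P :=
    hD.integrable_comp h.measurable_atom h.atom_mem h.measurable_Lam h.Lam_mem continuous_recourse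
  have hi2 : Integrable (fun ω => (D.W *ᵥ Xt ω + D.b) ⬝ᵥ Lam ω) P :=
    hD.integrable_comp h.measurable_Xt h.Xt_mem h.measurable_Lam h.Lam_mem continuous_recourse
  have hi3 : ∀ i ∈ Finset.univ, Integrable (fun ω => |A ω i - Xt ω i| * M) P := by
    intro i _
    refine Integrable.mul_const (Integrable.abs (Integrable.sub ?_ ?_)) M
    · exact hD.integrable_comp h.measurable_atom h.atom_mem h.measurable_Lam h.Lam_mem
        (F := fun z => z.1 i) (by fun_prop)
    · exact hD.integrable_comp h.measurable_Xt h.Xt_mem h.measurable_Lam h.Lam_mem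
        (F := fun z => z.1 i) (by fun_prop)
  rw [← h.integral_atom fun z => (D.W *ᵥ z.1 + D.b) ⬝ᵥ z.2, ← integral_sub hi1 hi2,
    Finset.sum_mul]
  calc ∫ ω, ((D.W *ᵥ A ω + D.b) ⬝ᵥ Lam ω - (D.W *ᵥ Xt ω + D.b) ⬝ᵥ Lam ω) ∂P
      ≤ ∫ ω, ∑ i, |A ω i - Xt ω i| * M ∂P := by
        refine integral_mono (hi1.sub hi2) (integrable_finsetSum _ hi3) fun ω => ?_
        simp only [add_dotProduct, dotProduct_eq_sum_transpose, add_sub_add_right_eq_sub,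
          ← Finset.sum_sub_distrib, ← mul_sub]
        refine Finset.sum_le_sum fun i _ => ?_
        refine (le_abs_self _).trans ?_
        rw [abs_mul, mul_comm]
        refine mul_le_mul_of_nonneg_left ?_ (abs_nonneg _)
        exact (norm_le_pi_norm (D.Wᵀ *ᵥ Lam ω) i).trans (hMle _ (h.Lam_mem ω))
    _ = ∑ i, (∫ ω, |A ω i - Xt ω i| ∂P) * M := by
        rw [integral_finsetSum _ hi3]
        simp only [integral_mul_const]
    _ ≤ _ := Finset.sum_le_sum fun i _ => mul_le_mul_of_nonneg_right
        (integral_abs_sub_le_W1bar (isCompact_X i).isBounded (hD.prob i)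
          ((measurable_pi_apply i).comp h.measurable_atom)
          ((measurable_pi_apply i).comp h.measurable_Xt)
          (h.map_atom_mem_momentSet hD hv i) (h.map_Xt i) (h.nested i)) hM0

end ComonotonePair

/-! ### Existence of a reassembly -/

lemma exists_isReassembly {cuts : Finset D.Point} {p : D.Point → ℝ}
    (hp : ∀ z ∈ cuts, 0 ≤ p z) (hp1 : ∑ z ∈ cuts, p z = 1) :
    ∃ (Ω : Type w) (_ : MeasurableSpace Ω) (P : Measure Ω) (Xt : Ω → Fin N → ℝ)
      (Lam : Ω → Fin K₂ → ℝ), D.IsReassembly P cuts p Xt Lam := by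
  classical
  let T := cuts.filter fun z => 0 < p z
  let e := T.equivFin
  let pts : Fin T.card → D.Point := fun j => (e.symm j : D.Point)
  have hinj : Function.Injective pts := Subtype.val_injective.comp e.symm.injective
  have hpts : ∀ z, z ∈ range pts ↔ z ∈ cuts ∧ 0 < p z := fun z => by
    rw [← Finset.mem_filter (p := fun z => 0 < p z)]
    constructor
    · rintro ⟨j, rfl⟩
      exact (e.symm j).2
    · exact fun hz => ⟨e ⟨z, hz⟩, by simp [pts]⟩
  have hα : ∀ j, 0 ≤ p (pts j) := fun j => ((hpts _).1 ⟨j, rfl⟩).2.le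
  have hα1 : ∑ j, p (pts j) = 1 := by
    have := sum_atoms hinj hp hpts fun _ => 1
    simpa [hp1] using this
  -- `Tuple.sort` sends ranks to indices; `σ` has to send indices to ranks.
  let σ : Fin N → Equiv.Perm (Fin T.card) := fun i => (Tuple.sort fun j => (pts j).1 i).symm
  let P₁ : Measure (ULift.{w} (Fin T.card)) :=
    ∑ j, ENNReal.ofReal (p (pts j)) • Measure.dirac (ULift.up j)
  have hP₁ : IsProbabilityMeasure P₁ := ⟨by
    simp only [P₁, Measure.finsetSum_apply, Measure.smul_apply, measure_univ, smul_eq_mul,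
      mul_one]
    rw [← ENNReal.ofReal_sum_of_nonneg fun j _ => hα j, hα1, ENNReal.ofReal_one]⟩
  let P₂ : Measure (ULift.{w} unitInterval) := volume.map ULift.up
  have hP₂ : IsProbabilityMeasure P₂ :=
    Measure.isProbabilityMeasure_map measurable_up.aemeasurable
  let Z : ULift.{w} (Fin T.card) × ULift.{w} unitInterval → Fin T.card := fun ω => ω.1.down
  -- One uniform variable serves all coordinates, since only the marginals of `C` are prescribed.
  -- `ULift` places the space in the required universe.
  let C : ULift.{w} (Fin T.card) × ULift.{w} unitInterval → Fin N → ℝ :=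
    fun ω _ => (ω.2.down : ℝ)
  have hC₂ : Measurable fun ω : ULift.{w} unitInterval => (ω.down : ℝ) :=
    measurable_subtype_coe.comp measurable_down
  refine ⟨ULift.{w} (Fin T.card) × ULift.{w} unitInterval, inferInstance, P₁.prod P₂,
    fun ω i => quantile (D.X i) (D.μ i)
      (C ω i * cumWeight (fun j => p (pts j)) (σ i) ((σ i (Z ω) : ℕ) + 1) +
        (1 - C ω i) * cumWeight (fun j => p (pts j)) (σ i) (σ i (Z ω) : ℕ)),
    fun ω => (pts (Z ω)).2, inferInstance, T.card, pts, σ, Z, C, hinj, hpts, fun i => ?_,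
    measurable_down.comp measurable_fst, fun j => ?_, ?_, fun ω i => ω.2.down.2, fun i => ?_, ?_,
    fun _ => rfl, fun _ _ => rfl⟩
  · exact Tuple.monotone_sort fun j => (pts j).1 i
  · have hset : {ω | Z ω = j} = ({ULift.up j} : Set (ULift.{w} (Fin T.card))) ×ˢ univ := by
      ext ω
      simp [Z, ULift.ext_iff]
    rw [hset, measureReal_def, Measure.prod_prod, measure_univ, mul_one, Measure.finsetSum_apply,
      Finset.sum_eq_single j]
    · simp [hα j]
    · intro k _ hk
      simp [hk]
    · simp
  · exact measurable_pi_lambda _ fun i => hC₂.comp measurable_snd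
  · have : (fun ω => C ω i) = (fun ω : ULift.{w} unitInterval => (ω.down : ℝ)) ∘ Prod.snd := rfl
    rw [this, ← Measure.map_map hC₂ measurable_snd, Measure.map_snd_prod, measure_univ, one_smul,
      Measure.map_map hC₂ measurable_up]
    exact unitInterval.measurePreserving_coe.map_eq
  · exact (indepFun_prod (X := fun ω : ULift.{w} (Fin T.card) => ω.down)
      (Y := fun (ω : ULift.{w} unitInterval) (_ : Fin N) => (ω.down : ℝ)) measurable_down
      (measurable_pi_lambda _ fun _ => hC₂)).symm

end Data

end TwoStageDRO

/-! ### The main theorem -/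

theorem theorem5 {N K₁ nin neq K₂ : ℕ}
    (D : TwoStageDRO.Data N K₁ nin neq K₂)
    (hD : D.Assumptions) (hA1 : D.CondA1) (hA2 : D.CondA2)
    (cuts₀ : Finset D.Point)
    (hcuts₀ : ∀ z ∈ cuts₀, z.1 ∈ D.XX ∧ z.2 ∈ D.S₂)
    (hbdd : D.BoundedSublevel (cuts₀ : Set D.Point))
    (ε : ℝ) (hε : 0 < ε) :
    D.AlwaysTerminates ε cuts₀ ∧
    (∃ (UB LB εhat : ℝ) (ahat : Fin K₁ → ℝ),
      TwoStageDRO.Data.IsOutput.{w} D ε cuts₀ UB LB εhat ahat) ∧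
    ∀ (UB LB εhat : ℝ) (ahat : Fin K₁ → ℝ),
      TwoStageDRO.Data.IsOutput.{w} D ε cuts₀ UB LB εhat ahat →
      ((LB : EReal) ≤ D.φDRO ∧ D.φDRO ≤ D.φ ahat ∧ D.φ ahat ≤ (UB : EReal)) ∧
      D.IsOptimalUpTo εhat ahat ∧
      εhat ≤ ε + (∑ i, (TwoStageDRO.W1bar (D.X i)
          (TwoStageDRO.cpwaSet (D.knot i)) (D.μ i)).toReal) *
        sSup ((fun lam => ‖D.Wᵀ *ᵥ lam‖) '' D.S₂) := by
  have hterm := hD.alwaysTerminates hε hcuts₀ hbdd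
  refine ⟨hterm, ?_, ?_⟩
  · obtain ⟨cuts, I, hlast⟩ := hterm.exists_stopsWith
    have hdual := hlast.2.1.dual.1
    obtain ⟨Ω, mΩ, P, Xt, Lam, h⟩ :=
      TwoStageDRO.Data.exists_isReassembly.{w} hdual.2.2.2.2 hdual.2.1
    exact ⟨_, _, _, _, cuts, I, hlast, Ω, mΩ, P, Xt, Lam, h, rfl, rfl, rfl, rfl⟩
  · rintro UB LB εhat ahat ⟨cuts, I, ⟨hreach, hI, hgap⟩, Ω, mΩ, P, Xt, Lam, h, rfl, rfl, rfl, rfl⟩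
    have hdual := hI.dual.1
    obtain ⟨A, hA⟩ := h.exists_isComonotonePair hD (hD.reachable hcuts₀ hreach).2
      hdual.2.2.2.2 hdual.2.1
    have ha : I.a ∈ D.S₁ := (TwoStageDRO.Data.mem_relaxFeasible.1 hI.primal.1).2
    have h1 := hD.lower_le_φDRO hA hdual
    have h2 : D.φDRO ≤ D.φ I.a := iInf₂_le I.a ha
    have h3 := hD.φ_le_upper hI
    refine ⟨⟨h1, h2, h3⟩, ⟨ha, h3.trans ?_⟩, ?_⟩
    · refine le_trans (le_of_eq ?_) (add_le_add_left h1 _)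
      rw [← EReal.coe_add, add_sub_cancel]
    -- The error is `(UB - lower) + (lower - LB)`: the first part is at most `ε` by the stopping
    -- rule, and strong duality bounds the second by the reassembly cost.
    · have h4 := hD.dualObj_sub_le hA hdual.2.2.1
      have h5 : I.lower ≤ D.dualObj cuts I.ξin I.ξeq I.p :=
        hI.primal.relaxObj_le_dualObj hI.dual
      rw [TwoStageDRO.Data.dualObj] at h5
      linarith
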